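/- Let $d\ge 2$ and let $f:\mathbb{R}^d\to\mathbb{R}$ be twice differentiable, $\mu$-strongly convex and $L$-smooth, i.e. $\mu I_d\preceq\nabla^2 f(x)\preceq L I_d$ for all $x$ ($\mu,L>0$), with condition number $\varkappa=L/\mu$, and $M$-strongly self-concordant ($M>0$), i.e. $\nabla^2 f(y)-\nabla^2 f(x)\preceq M\|y-x\|_{z}\,\nabla^2 f(w)$ for all $x,y,z,w\in\mathbb{R}^d$, where $\|v\|_{z}=\sqrt{v^\top\nabla^2 f(z)\,v}$. Put $\lambda_f(x)=\sqrt{\nabla f(x)^\top[\nabla^2 f(x)]^{-1}\nabla f(x)}$. For $\tau\in\mathbb{R}$, symmetric $G\succeq A\succ0$ and $u\in\mathbb{R}^d$, let $\mathrm{Broyd}_\tau(G,A,u)=G$ if $Gu=Au$, and otherwise $$\mathrm{Broyd}_\tau(G,A,u)=\tau\Big[G-\tfrac{Auu^\top G+Guu^\top A}{u^\top Au}+\Big(\tfrac{u^\top Gu}{u^\top Au}+1\Big)\tfrac{Auu^\top A}{u^\top Au}\Big]+(1-\tau)\Big[G-\tfrac{(G-A)uu^\top(G-A)}{u^\top(G-A)u}\Big].$$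 Let $\mathcal{D}$ be a probability distribution on $\mathbb{R}^d$ with $\mathbb{E}_{u\sim\mathcal{D}}\big[\tfrac{uu^\top}{u^\top u}\big]=\tfrac1d I_d$. Starting from a deterministic $x_0\in\mathbb{R}^d$ and $G_0=L I_d$, the random Broyden-family method computes, for $k\ge0$, $$x_{k+1}=x_k-G_k^{-1}\nabla f(x_k),\quad r_k=\|x_{k+1}-x_k\|_{x_k},\quad G_{k+1}=\mathrm{Broyd}_{\tau_k}\big((1+Mr_k)G_k,\nabla^2 f(x_{k+1}),u_k\big),$$ where $u_k\sim\mathcal{D}$ is drawn independently of everything that happened before step $k$, and $\tau_k\in[0,1]$ may be chosen, measurably, from all information available once $u_k$ has been drawn. Write $\lambda_k=\lambda_f(x_k)$. There are a universal constant $C$ and integers $k_0=k_0(d,\varkappa,\delta)\ge0$, depending only on $d$, $\varkappa\ge1$ and $\delta\in(0,1)$, with $k_0\le C\,d\varkappa\ln(d\varkappa/\delta)$, such that the following holds. If $M\lambda_0\le\frac{\ln(3/2)}{4\varkappa}$, then for every $\delta\in(0,1)$, with probability at least $1-\delta$, $$\lambda_{k_0+k}\le\Big(1-\frac{1}{d\varkappa+1}\Big)^{k(k-1)/2}\Big(\frac12\Big)^k\Big(1-\frac{1}{2\varkappa}\Big)^{k_0}\lambda_0\qquad\text{for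 all }k\ge0.$$ -/

import Mathlib

open Matrix MeasureTheory ProbabilityTheory

namespace RandomBroyden

noncomputable section

/-- The Hessian matrix `∇²f(x)` in the standard basis: the Jacobian matrix of the gradient. -/
def hessian {d : ℕ} (f : EuclideanSpace ℝ (Fin d) → ℝ) (x : EuclideanSpace ℝ (Fin d)) :
    Matrix (Fin d) (Fin d) ℝ :=
  Matrix.of fun i j => (fderiv ℝ (gradient f) x (EuclideanSpace.single j 1)) i

/-- The norm `‖v‖_A = √(vᵀ A v)` induced by a positive definite matrix `A`. -/
def matNorm {d : ℕ} (A : Matrix (Fin d) (Fin d) ℝ) (v : Fin d → ℝ) : ℝ :=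
  Real.sqrt (v ⬝ᵥ A *ᵥ v)

/-- `λ_f(x) = √(∇f(x)ᵀ [∇²f(x)]⁻¹ ∇f(x))`. -/
def lambda {d : ℕ} (f : EuclideanSpace ℝ (Fin d) → ℝ) (x : EuclideanSpace ℝ (Fin d)) : ℝ :=
  matNorm (hessian f x)⁻¹ (gradient f x).ofLp

/-- `f` is twice differentiable on `ℝᵈ`. -/
def TwiceDifferentiable {d : ℕ} (f : EuclideanSpace ℝ (Fin d) → ℝ) : Prop :=
  Differentiable ℝ f ∧ Differentiable ℝ (gradient f)

/-- `f` is `μ`-strongly convex and `L`-smooth: `μ I ⪯ ∇²f(x) ⪯ L I` for all `x`. -/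
structure StronglyConvexSmooth {d : ℕ} (μ L : ℝ) (f : EuclideanSpace ℝ (Fin d) → ℝ) : Prop where
  mu_pos : 0 < μ
  L_pos : 0 < L
  twiceDifferentiable : TwiceDifferentiable f
  lower : ∀ x, (hessian f x - μ • (1 : Matrix (Fin d) (Fin d) ℝ)).PosSemidef
  upper : ∀ x, (L • (1 : Matrix (Fin d) (Fin d) ℝ) - hessian f x).PosSemidef

/-- `f` is `M`-strongly self-concordant:
`∇²f(y) - ∇²f(x) ⪯ M ‖y - x‖_z ∇²f(w)` for all `x, y, z, w`. -/
structure StronglySelfConcordant {d : ℕ} (M : ℝ) (f : EuclideanSpace ℝ (Fin d) → ℝ) :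
    Prop where
  M_pos : 0 < M
  twiceDifferentiable : TwiceDifferentiable f
  bound : ∀ x y z w, ((M * matNorm (hessian f z) (y - x).ofLp) • hessian f w
    - (hessian f y - hessian f x)).PosSemidef

open Classical in
/-- The Broyden family update `Broyd_τ(G, A, u)`, where `vecMulVec u v = u vᵀ`. -/
def broyd {d : ℕ} (τ : ℝ) (G A : Matrix (Fin d) (Fin d) ℝ) (u : Fin d → ℝ) :
    Matrix (Fin d) (Fin d) ℝ :=
  if G *ᵥ u = A *ᵥ u then G
  else
    τ • (G - (u ⬝ᵥ A *ᵥ u)⁻¹ • (A * vecMulVec u u * G + G * vecMulVec u u * A)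
        + (((u ⬝ᵥ G *ᵥ u) / (u ⬝ᵥ A *ᵥ u) + 1) / (u ⬝ᵥ A *ᵥ u)) • (A * vecMulVec u u * A))
    + (1 - τ) • (G - (u ⬝ᵥ (G - A) *ᵥ u)⁻¹ • ((G - A) * vecMulVec u u * (G - A)))

/-- The quasi-Newton step `x₊ = x - G⁻¹ ∇f(x)`. -/
def newtonStep {d : ℕ} (f : EuclideanSpace ℝ (Fin d) → ℝ) (x : EuclideanSpace ℝ (Fin d))
    (G : Matrix (Fin d) (Fin d) ℝ) : EuclideanSpace ℝ (Fin d) :=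
  x - WithLp.toLp 2 (G⁻¹ *ᵥ (gradient f x).ofLp)

/-- The iterates `(x_k, G_k)` of the quasi-Newton method started at `x₀` and `G₀ = L I`, run with
the directions `u_k` and the parameters `τ_k`:
`x_{k+1} = x_k - G_k⁻¹ ∇f(x_k)`, `r_k = ‖x_{k+1} - x_k‖_{∇²f(x_k)}`,
`G_{k+1} = Broyd_{τ_k}((1 + M r_k) G_k, ∇²f(x_{k+1}), u_k)`. -/
def iterates {d : ℕ} (f : EuclideanSpace ℝ (Fin d) → ℝ) (M L : ℝ)
    (x₀ : EuclideanSpace ℝ (Fin d)) (u : ℕ → EuclideanSpace ℝ (Fin d)) (τ : ℕ → ℝ) :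
    ℕ → EuclideanSpace ℝ (Fin d) × Matrix (Fin d) (Fin d) ℝ
  | 0 => (x₀, L • 1)
  | k + 1 =>
    let x := (iterates f M L x₀ u τ k).1
    let G := (iterates f M L x₀ u τ k).2
    let x' := newtonStep f x G
    let r := matNorm (hessian f x) (x' - x).ofLp
    (x', broyd (τ k) ((1 + M * r) • G) (hessian f x') (u k).ofLp)

/-- The direction distribution satisfies `𝔼_{u ∼ D} [u uᵀ / (uᵀ u)] = (1/d) I`. The value of the
integrand at `u = 0` is `0`; the trace of the identity forces `D {0} = 0` when `d ≥ 1`. -/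
def IsotropicDirection {d : ℕ} (D : Measure (EuclideanSpace ℝ (Fin d))) : Prop :=
  ∀ i j, ∫ u, u i * u j / (u.ofLp ⬝ᵥ u.ofLp) ∂D
    = ((1 / (d : ℝ)) • (1 : Matrix (Fin d) (Fin d) ℝ)) i j

/-- Random directions `u_k` and parameters `τ_k ∈ [0, 1]`. Here `ℱ k` is the information available
before step `k`; `u_k` is a fresh draw from `D`, independent of `ℱ k`, and `τ_k` is chosen in an
arbitrary measurable way from the information available after `u_k` has been drawn. -/
structure RandomChoices {d : ℕ} {Ω : Type*} [mΩ : MeasurableSpace Ω] (P : Measure Ω)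
    (ℱ : Filtration ℕ mΩ) (D : Measure (EuclideanSpace ℝ (Fin d)))
    (u : ℕ → Ω → EuclideanSpace ℝ (Fin d)) (τ : ℕ → Ω → ℝ) : Prop where
  u_measurable : ∀ k, Measurable[ℱ (k + 1)] (u k)
  u_law : ∀ k, P.map (u k) = D
  u_indep : ∀ k, Indep (MeasurableSpace.comap (u k) inferInstance) (ℱ k) P
  tau_measurable : ∀ k, Measurable[ℱ (k + 1)] (τ k)
  tau_mem : ∀ k ω, τ k ω ∈ Set.Icc (0 : ℝ) 1

end

end RandomBroyden

/-!
The iterates are followed through two quantities: `λ_k = λ_f(x_k)` and the trace potential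
`σ_k = tr(∇²f(x_k)⁻¹ (G_k - ∇²f(x_k)))`. If `∇²f(x_k) ⪯ G_k ⪯ η ∇²f(x_k)` and `m = M λ_k`, one
quasi-Newton step gives `λ_{k+1} ≤ (1 + m/2) (1 - 1/η + m/2) λ_k` (`lambda_newtonStep_le`).

*Linear phase.* The update never destroys `∇²f(x_k) ⪯ G_k` and does not increase `η`
(`le_broyd`, `broyd_le_smul`), while the correction by `1 + M r_k` and the change of the base point
increase `η` by a factor of at most `(1 + M λ_k)²`. Starting from `η = κ`, the smallness of `M λ_0`
keeps `η ≤ 3κ/2` along every run, which yields the deterministic bound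
`λ_k ≤ (1 - 13/(24κ))ᵏ λ_0` (`iteratesBounds`).

*The potential.* For every `τ ∈ [0, 1]`, even if it depends on `u`, the update with the direction
`u` decreases the potential by at least `uᵀ R u / (uᵀ ∇²f u)`, with `R` the error before the update
(`trace_inv_mul_broyd_le`). Since `u_k` is isotropic and independent of the past, the expected
potential is multiplied by at most `1 - 1/(dκ)` in an update. Before it, the potential changes from
`σ_k` to at most `(1 + m)² (σ_k + 2 d m)`. The deterministic bound on `m` decays strictly faster
than `(1 - 1/(dκ))ᵏ`, so the recursion closes and `𝔼 σ_k ≤ 9 dκ (1 - 1/(dκ))ᵏ`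
(`RandomChoices.integral_potential_le`).

*Superlinear phase.* As `1 + σ_k` is an admissible value of `η`, the step also satisfies
`λ_{k+1} ≤ (1 + m/2) (σ_k + m/2) λ_k`. By Markov's inequality and a union bound, after
`k₀ = O(dκ ln(dκ/δ))` steps one has `σ_{k₀+j} ≤ (2/5) (1 - 1/(dκ+1))ʲ` for all `j` simultaneously,
with probability at least `1 - δ`; the slightly slower rate `1 - 1/(dκ+1)` makes the failure
probabilities summable. Multiplying the step bounds gives the product of the rates
(`lambda_iterates_le_of_potential_le`).
-/

namespace RandomBroyden

/-! ### Quadratic forms, traces and the Loewner order -/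

section LoewnerOrder

open scoped MatrixOrder

variable {n : Type*}

lemma isHermitian_of_nonneg {A : Matrix n n ℝ} (hA : 0 ≤ A) : A.IsHermitian :=
  (nonneg_iff_posSemidef.1 hA).isHermitian

lemma nonneg_of_posDef {A : Matrix n n ℝ} (hA : A.PosDef) : 0 ≤ A :=
  nonneg_iff_posSemidef.2 hA.posSemidef

lemma posDef_of_le {A B : Matrix n n ℝ} (hA : A.PosDef) (h : A ≤ B) : B.PosDef := by
  simpa using hA.add_posSemidef (le_iff.1 h)

lemma posDef_of_smul_one_le [DecidableEq n] {A : Matrix n n ℝ} {c : ℝ} (hc : 0 < c)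
    (h : c • (1 : Matrix n n ℝ) ≤ A) : A.PosDef := by
  have := (PosDef.one (n := n) (R := ℝ)).smul hc
  simpa using this.add_posSemidef (le_iff.1 h)

variable [Fintype n]

lemma dotProduct_mulVec_comm_of_isHermitian {A : Matrix n n ℝ} (hA : A.IsHermitian) (v w : n → ℝ) :
    v ⬝ᵥ A *ᵥ w = w ⬝ᵥ A *ᵥ v := by
  have h : Aᵀ = A := by rwa [← conjTranspose_eq_transpose_of_trivial]
  rw [dotProduct_mulVec, ← mulVec_transpose, h, dotProduct_comm]

lemma quad_add_smul {A : Matrix n n ℝ} (hA : A.IsHermitian) (v w : n → ℝ) (t : ℝ) :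
    (v + t • w) ⬝ᵥ A *ᵥ (v + t • w)
      = v ⬝ᵥ A *ᵥ v + 2 * t * (v ⬝ᵥ A *ᵥ w) + t ^ 2 * (w ⬝ᵥ A *ᵥ w) := by
  simp only [mulVec_add, mulVec_smul, dotProduct_add, add_dotProduct, dotProduct_smul,
    smul_dotProduct, smul_eq_mul]
  rw [dotProduct_mulVec_comm_of_isHermitian hA w v]
  ring

lemma quad_nonneg {A : Matrix n n ℝ} (hA : 0 ≤ A) (v : n → ℝ) : 0 ≤ v ⬝ᵥ A *ᵥ v := by
  simpa using (nonneg_iff_posSemidef.1 hA).dotProduct_mulVec_nonneg v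

lemma quad_mono {A B : Matrix n n ℝ} (h : A ≤ B) (v : n → ℝ) :
    v ⬝ᵥ A *ᵥ v ≤ v ⬝ᵥ B *ᵥ v := by
  have := quad_nonneg (sub_nonneg.2 h) v
  rw [sub_mulVec, dotProduct_sub] at this
  linarith

lemma le_of_quad_le {A B : Matrix n n ℝ} (hA : A.IsHermitian) (hB : B.IsHermitian)
    (h : ∀ v, v ⬝ᵥ A *ᵥ v ≤ v ⬝ᵥ B *ᵥ v) : A ≤ B := by
  refine PosSemidef.of_dotProduct_mulVec_nonneg (hB.sub hA) fun v => ?_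
  rw [sub_mulVec, dotProduct_sub]
  simpa using h v

/-- Cauchy–Schwarz for the quadratic form of a positive semidefinite matrix. -/
lemma sq_dotProduct_mulVec_le {A : Matrix n n ℝ} (hA : 0 ≤ A) (v w : n → ℝ) :
    (v ⬝ᵥ A *ᵥ w) ^ 2 ≤ (v ⬝ᵥ A *ᵥ v) * (w ⬝ᵥ A *ᵥ w) := by
  have h := discrim_le_zero (a := w ⬝ᵥ A *ᵥ w) (b := 2 * (v ⬝ᵥ A *ᵥ w)) (c := v ⬝ᵥ A *ᵥ v)
    fun t => by
      have := quad_nonneg hA (v + t • w)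
      rw [quad_add_smul (isHermitian_of_nonneg hA)] at this
      linarith
  rw [discrim] at h
  linarith

lemma mulVec_eq_zero_of_quad_eq_zero {A : Matrix n n ℝ} (hA : 0 ≤ A) {v : n → ℝ}
    (hv : v ⬝ᵥ A *ᵥ v = 0) : A *ᵥ v = 0 := by
  have := sq_dotProduct_mulVec_le hA (A *ᵥ v) v
  rw [hv, mul_zero] at this
  exact dotProduct_self_eq_zero.1
    (pow_eq_zero_iff two_ne_zero |>.1 (le_antisymm this (sq_nonneg _)))

/-- A symmetric form dominated by `c • H` in absolute value is bounded by `c ‖v‖_H ‖w‖_H` off the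
diagonal as well, by polarization. -/
lemma sq_dotProduct_mulVec_le_of_abs_le {B H : Matrix n n ℝ} {c : ℝ} (hB : B.IsHermitian)
    (hH : H.IsHermitian) (h : ∀ v, |v ⬝ᵥ B *ᵥ v| ≤ c * (v ⬝ᵥ H *ᵥ v)) (v w : n → ℝ) :
    (v ⬝ᵥ B *ᵥ w) ^ 2 ≤ c ^ 2 * ((v ⬝ᵥ H *ᵥ v) * (w ⬝ᵥ H *ᵥ w)) := by
  have h := discrim_le_zero (a := c * (w ⬝ᵥ H *ᵥ w)) (b := 2 * (v ⬝ᵥ B *ᵥ w))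
    (c := c * (v ⬝ᵥ H *ᵥ v)) fun t => by
      have h1 := (abs_le.1 (h (v + t • w))).1
      have h2 := (abs_le.1 (h (v + (-t) • w))).2
      rw [quad_add_smul hB, quad_add_smul hH] at h1 h2
      nlinarith
  rw [discrim] at h
  nlinarith

lemma quad_pos {A : Matrix n n ℝ} (hA : A.PosDef) {v : n → ℝ} (hv : v ≠ 0) :
    0 < v ⬝ᵥ A *ᵥ v := by
  simpa using hA.dotProduct_mulVec_pos hv

/-- For `R = BᵀB` with rows `bᵢ` of `B`, `tr (A R) = ∑ᵢ bᵢᵀ A bᵢ`. -/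
lemma trace_mul_transpose_mul (A B : Matrix n n ℝ) :
    (A * (Bᵀ * B)).trace = ∑ i, B i ⬝ᵥ A *ᵥ B i := by
  rw [← mul_assoc, trace_mul_comm, ← mul_assoc, trace]
  refine Finset.sum_congr rfl fun i _ => ?_
  rw [diag_apply, mul_assoc, mul_apply]
  rfl

variable [DecidableEq n]

lemma mulVec_inv_mulVec {A : Matrix n n ℝ} (hA : A.PosDef) (v : n → ℝ) : A *ᵥ A⁻¹ *ᵥ v = v := by
  rw [mulVec_mulVec, mul_nonsing_inv _ ((isUnit_iff_isUnit_det _).1 hA.isUnit), one_mulVec]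

lemma inv_mulVec_mulVec {A : Matrix n n ℝ} (hA : A.PosDef) (v : n → ℝ) : A⁻¹ *ᵥ A *ᵥ v = v := by
  rw [mulVec_mulVec, nonsing_inv_mul _ ((isUnit_iff_isUnit_det _).1 hA.isUnit), one_mulVec]

/-- The dual form of Cauchy–Schwarz: `(vᵀw)² ≤ ‖v‖²_{A⁻¹} ‖w‖²_A`. -/
lemma sq_dotProduct_le_inv_mul {A : Matrix n n ℝ} (hA : A.PosDef) (v w : n → ℝ) :
    (v ⬝ᵥ w) ^ 2 ≤ (v ⬝ᵥ A⁻¹ *ᵥ v) * (w ⬝ᵥ A *ᵥ w) := by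
  have h := sq_dotProduct_mulVec_le (nonneg_of_posDef hA) w (A⁻¹ *ᵥ v)
  rw [mulVec_inv_mulVec hA, dotProduct_comm w v, dotProduct_comm (A⁻¹ *ᵥ v) v] at h
  linarith

/-- Inversion reverses the Loewner order. -/
lemma inv_quad_le_of_le_smul {A B : Matrix n n ℝ} {c : ℝ} (hA : A.PosDef) (hB : B.PosDef)
    (h : A ≤ c • B) (v : n → ℝ) : v ⬝ᵥ B⁻¹ *ᵥ v ≤ c * (v ⬝ᵥ A⁻¹ *ᵥ v) := by
  set w := B⁻¹ *ᵥ v with hw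
  have h1 := sq_dotProduct_le_inv_mul hA v w
  have h2 := quad_mono h w
  rw [smul_mulVec, dotProduct_smul, smul_eq_mul, hw, mulVec_inv_mulVec hB,
    dotProduct_comm _ v, ← hw] at h2
  have h3 : 0 ≤ v ⬝ᵥ w := quad_nonneg (nonneg_of_posDef hB.inv) v
  have h4 : 0 ≤ v ⬝ᵥ A⁻¹ *ᵥ v := quad_nonneg (nonneg_of_posDef hA.inv) v
  rcases h3.eq_or_lt with h0 | h0
  · have h5 := mulVec_eq_zero_of_quad_eq_zero (nonneg_of_posDef hB.inv) (v := v) h0.symm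
    have h6 : v = 0 := by rw [← mulVec_inv_mulVec hB v, h5, mulVec_zero]
    simp [hw, h6]
  · have h5 : (v ⬝ᵥ w) ^ 2 ≤ (v ⬝ᵥ A⁻¹ *ᵥ v) * (c * (v ⬝ᵥ w)) :=
      h1.trans (mul_le_mul_of_nonneg_left h2 h4)
    have h6 : (v ⬝ᵥ w) * (v ⬝ᵥ w) ≤ (c * (v ⬝ᵥ A⁻¹ *ᵥ v)) * (v ⬝ᵥ w) := by nlinarith
    exact le_of_mul_le_mul_right h6 h0

/-- If `0 ⪯ R ⪯ c H` then `R H⁻¹ R ⪯ c R`. -/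
lemma quad_inv_mulVec_le {R H : Matrix n n ℝ} {c : ℝ} (hH : H.PosDef) (hR : 0 ≤ R)
    (h : R ≤ c • H) (s : n → ℝ) :
    (R *ᵥ s) ⬝ᵥ H⁻¹ *ᵥ (R *ᵥ s) ≤ c * (s ⬝ᵥ R *ᵥ s) := by
  set v := H⁻¹ *ᵥ (R *ᵥ s) with hv
  have e1 : (R *ᵥ s) ⬝ᵥ v = v ⬝ᵥ R *ᵥ s := dotProduct_comm _ _
  have h1 := sq_dotProduct_mulVec_le hR v s
  have h2 := quad_mono h v
  have e2 : v ⬝ᵥ H *ᵥ v = v ⬝ᵥ R *ᵥ s := by rw [hv, mulVec_inv_mulVec hH]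
  rw [smul_mulVec, dotProduct_smul, smul_eq_mul, e2] at h2
  rw [e1]
  have h3 : 0 ≤ v ⬝ᵥ R *ᵥ s := e1 ▸ quad_nonneg (nonneg_of_posDef hH.inv) _
  have h4 := quad_nonneg hR s
  rcases h3.eq_or_lt with h0 | h0
  · rw [← h0]
    have h5 : v ⬝ᵥ H *ᵥ v = 0 := by rw [e2, ← h0]
    have h6 := mulVec_eq_zero_of_quad_eq_zero (nonneg_of_posDef hH) h5
    rw [hv, mulVec_inv_mulVec hH] at h6
    rw [h6]
    simp
  · have : (v ⬝ᵥ R *ᵥ s) * (v ⬝ᵥ R *ᵥ s) ≤ (c * (s ⬝ᵥ R *ᵥ s)) * (v ⬝ᵥ R *ᵥ s) := by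
      nlinarith [mul_le_mul_of_nonneg_right h2 h4]
    exact le_of_mul_le_mul_right this h0

/-- If `H ⪯ G ⪯ η H` then `‖(G - H) s‖_{H⁻¹} ≤ (1 - 1/η) ‖G s‖_{H⁻¹}`. -/
lemma quad_inv_sub_mulVec_le {G H : Matrix n n ℝ} {η : ℝ} (hη : 1 ≤ η) (hH : H.PosDef)
    (h1 : H ≤ G) (h2 : G ≤ η • H) (s : n → ℝ) :
    ((G - H) *ᵥ s) ⬝ᵥ H⁻¹ *ᵥ ((G - H) *ᵥ s)
      ≤ (1 - 1 / η) ^ 2 * ((G *ᵥ s) ⬝ᵥ H⁻¹ *ᵥ (G *ᵥ s)) := by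
  have hR : 0 ≤ G - H := sub_nonneg.2 h1
  have hR2 : G - H ≤ (η - 1) • H := by
    rw [sub_smul, one_smul]; exact sub_le_sub_right h2 H
  have k1 := quad_inv_mulVec_le hH hR hR2 s
  have k2 := quad_mono hR2 s
  rw [smul_mulVec, dotProduct_smul, smul_eq_mul] at k2
  have k3 := quad_nonneg hR s
  have e : (G *ᵥ s) ⬝ᵥ H⁻¹ *ᵥ (G *ᵥ s) = ((G - H) *ᵥ s) ⬝ᵥ H⁻¹ *ᵥ ((G - H) *ᵥ s)
      + 2 * (s ⬝ᵥ (G - H) *ᵥ s) + s ⬝ᵥ H *ᵥ s := by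
    have e0 : G *ᵥ s = (G - H) *ᵥ s + (1 : ℝ) • H *ᵥ s := by rw [one_smul, ← add_mulVec]; simp
    rw [e0, quad_add_smul hH.inv.isHermitian, inv_mulVec_mulVec hH, dotProduct_comm _ s,
      dotProduct_comm _ s]
    ring
  rw [e]
  generalize ((G - H) *ᵥ s) ⬝ᵥ H⁻¹ *ᵥ ((G - H) *ᵥ s) = a at *
  generalize s ⬝ᵥ (G - H) *ᵥ s = b at *
  generalize s ⬝ᵥ H *ᵥ s = c at *
  have hc : 0 ≤ η - 1 := by linarith
  have h3 : η ^ 2 * a ≤ (η - 1) ^ 2 * (a + 2 * b + c) := by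
    nlinarith [mul_le_mul_of_nonneg_left k1 hc, mul_le_mul_of_nonneg_left k2 hc]
  have : (1 - 1 / η) ^ 2 * (a + 2 * b + c) = ((η - 1) ^ 2 * (a + 2 * b + c)) / η ^ 2 := by
    field_simp
  rw [this, le_div_iff₀ (by positivity)]
  linarith

lemma exists_transpose_mul_self {R : Matrix n n ℝ} (hR : 0 ≤ R) :
    ∃ B : Matrix n n ℝ, R = Bᵀ * B := by
  obtain ⟨B, hB⟩ := CStarAlgebra.nonneg_iff_eq_star_mul_self.1 hR
  exact ⟨B, by rw [hB, star_eq_conjTranspose, conjTranspose_eq_transpose_of_trivial]⟩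

lemma trace_mul_mono {A B R : Matrix n n ℝ} {c : ℝ} (hR : 0 ≤ R)
    (h : ∀ v, v ⬝ᵥ A *ᵥ v ≤ c * (v ⬝ᵥ B *ᵥ v)) : (A * R).trace ≤ c * (B * R).trace := by
  obtain ⟨C, rfl⟩ := exists_transpose_mul_self hR
  rw [trace_mul_transpose_mul, trace_mul_transpose_mul, Finset.mul_sum]
  exact Finset.sum_le_sum fun i _ => h _

lemma trace_mul_nonneg {A R : Matrix n n ℝ} (hA : 0 ≤ A) (hR : 0 ≤ R) : 0 ≤ (A * R).trace := by
  simpa using trace_mul_mono (A := 0) (B := A) (c := 1) hR fun v => by simpa using quad_nonneg hA v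

lemma trace_mul_mono_right {A R S : Matrix n n ℝ} (hA : 0 ≤ A) (h : R ≤ S) :
    (A * R).trace ≤ (A * S).trace := by
  have := trace_mul_nonneg hA (sub_nonneg.2 h)
  rw [mul_sub, trace_sub] at this
  linarith

/-- A positive semidefinite `R` satisfies `R ⪯ tr(H⁻¹ R) H`. -/
lemma le_trace_smul {R H : Matrix n n ℝ} (hH : H.PosDef) (hR : 0 ≤ R) :
    R ≤ (H⁻¹ * R).trace • H := by
  refine le_of_quad_le (isHermitian_of_nonneg hR)
    (isHermitian_of_nonneg (smul_nonneg (trace_mul_nonneg (nonneg_of_posDef hH.inv) hR)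
      (nonneg_of_posDef hH))) fun v => ?_
  obtain ⟨B, rfl⟩ := exists_transpose_mul_self hR
  rw [trace_mul_transpose_mul, smul_mulVec, dotProduct_smul, smul_eq_mul, Finset.sum_mul]
  have : v ⬝ᵥ (Bᵀ * B) *ᵥ v = ∑ i, (B i ⬝ᵥ v) ^ 2 := by
    rw [← mulVec_mulVec, dotProduct_mulVec, vecMul_transpose, dotProduct]
    exact Finset.sum_congr rfl fun i _ => (sq _).symm
  rw [this]
  exact Finset.sum_le_sum fun i _ => sq_dotProduct_le_inv_mul hH (B i) v

end LoewnerOrder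

/-! ### The Broyden update -/

section Update

open scoped MatrixOrder

lemma dotProduct_mul_vecMulVec_mul_mulVec {n : Type*} [Fintype n] (A B : Matrix n n ℝ)
    (u v w : n → ℝ) :
    v ⬝ᵥ (A * vecMulVec u u * B) *ᵥ w = (v ⬝ᵥ A *ᵥ u) * (u ⬝ᵥ B *ᵥ w) := by
  rw [← mulVec_mulVec, ← mulVec_mulVec, vecMulVec_mulVec]
  simp [mulVec_smul, mul_comm]

lemma trace_mul_mul_vecMulVec_mul {n : Type*} [Fintype n] (C A B : Matrix n n ℝ) (u : n → ℝ) :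
    (C * (A * vecMulVec u u * B)).trace = u ⬝ᵥ (B * C * A) *ᵥ u := by
  rw [← mul_assoc, trace_mul_comm, ← mul_assoc, ← mul_assoc, mul_vecMulVec, trace_vecMulVec,
    dotProduct_comm]

variable {d : ℕ} {τ η : ℝ} {G A : Matrix (Fin d) (Fin d) ℝ} {u : Fin d → ℝ}

lemma isHermitian_broyd (hG : G.IsHermitian) (hA : A.IsHermitian) :
    (broyd τ G A u).IsHermitian := by
  have hG' : Gᵀ = G := by rwa [← conjTranspose_eq_transpose_of_trivial]
  have hA' : Aᵀ = A := by rwa [← conjTranspose_eq_transpose_of_trivial]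
  rw [broyd]
  split_ifs
  · exact hG
  · rw [IsHermitian, conjTranspose_eq_transpose_of_trivial]
    simp only [transpose_add, transpose_sub, transpose_smul, transpose_mul, transpose_vecMulVec,
      hG', hA', mul_assoc]
    rw [add_comm (G * _) (A * _)]

lemma quad_update_pos (hA : A.PosDef) (h1 : A ≤ G) (hu : G *ᵥ u ≠ A *ᵥ u) :
    0 < u ⬝ᵥ A *ᵥ u ∧ 0 < u ⬝ᵥ (G - A) *ᵥ u := by
  refine ⟨quad_pos hA ?_, (quad_nonneg (sub_nonneg.2 h1) u).lt_of_ne' ?_⟩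
  · rintro rfl; simp at hu
  · intro h
    have := mulVec_eq_zero_of_quad_eq_zero (sub_nonneg.2 h1) h
    rw [sub_mulVec] at this
    exact hu (sub_eq_zero.1 this)

/-- The quadratic form of `Broyd_τ(G, A, u) - A`, as a convex combination of the forms of the DFP
update (`τ = 1`) and of the SR1 update (`τ = 0`). The DFP part is the form of `G - A` at the
projection of `v` along `u` onto the `A`-orthogonal complement of `u`. -/
lemma quad_broyd_sub (hA : A.PosDef) (h1 : A ≤ G) (hu : G *ᵥ u ≠ A *ᵥ u) (v : Fin d → ℝ) :
    v ⬝ᵥ (broyd τ G A u) *ᵥ v - v ⬝ᵥ A *ᵥ v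
      = τ * ((v + (-(v ⬝ᵥ A *ᵥ u / u ⬝ᵥ A *ᵥ u)) • u) ⬝ᵥ (G - A) *ᵥ
          (v + (-(v ⬝ᵥ A *ᵥ u / u ⬝ᵥ A *ᵥ u)) • u))
        + (1 - τ) * (v ⬝ᵥ (G - A) *ᵥ v - (v ⬝ᵥ (G - A) *ᵥ u) ^ 2 / u ⬝ᵥ (G - A) *ᵥ u) := by
  have hR : (G - A).IsHermitian := isHermitian_of_nonneg (sub_nonneg.2 h1)
  have hG : G.IsHermitian := by simpa using hR.add hA.isHermitian
  obtain ⟨ha, hr⟩ := quad_update_pos hA h1 hu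
  rw [broyd, if_neg hu, quad_add_smul hR]
  simp only [add_mulVec, sub_mulVec, smul_mulVec, dotProduct_add, dotProduct_sub, dotProduct_smul,
    smul_eq_mul, dotProduct_mul_vecMulVec_mul_mulVec] at hr ⊢
  rw [dotProduct_mulVec_comm_of_isHermitian hG u v,
    dotProduct_mulVec_comm_of_isHermitian hA.isHermitian u v]
  field_simp
  ring

lemma le_broyd (hτ : τ ∈ Set.Icc (0 : ℝ) 1) (hA : A.PosDef) (h1 : A ≤ G) :
    A ≤ broyd τ G A u := by
  by_cases hu : G *ᵥ u = A *ᵥ u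
  · rwa [broyd, if_pos hu]
  have hR := sub_nonneg.2 h1
  have hG : G.IsHermitian := by simpa using (isHermitian_of_nonneg hR).add hA.isHermitian
  refine le_of_quad_le hA.isHermitian (isHermitian_broyd hG hA.isHermitian) fun v => ?_
  have hr := (quad_update_pos hA h1 hu).2
  rw [← sub_nonneg, quad_broyd_sub hA h1 hu]
  refine add_nonneg (mul_nonneg hτ.1 (quad_nonneg hR _)) (mul_nonneg (by linarith [hτ.2]) ?_)
  rw [sub_nonneg, div_le_iff₀ hr]
  exact sq_dotProduct_mulVec_le hR v u

/-- The update does not increase the relative error `η` of the approximation. -/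
lemma broyd_le_smul (hτ : τ ∈ Set.Icc (0 : ℝ) 1) (hη : 1 ≤ η) (hA : A.PosDef) (h1 : A ≤ G)
    (h2 : G ≤ η • A) : broyd τ G A u ≤ η • A := by
  by_cases hu : G *ᵥ u = A *ᵥ u
  · rwa [broyd, if_pos hu]
  have hR := sub_nonneg.2 h1
  have hG : G.IsHermitian := by simpa using (isHermitian_of_nonneg hR).add hA.isHermitian
  have hA0 := nonneg_of_posDef hA
  have hR2 : G - A ≤ (η - 1) • A := by
    rw [sub_smul, one_smul]; exact sub_le_sub_right h2 A
  refine le_of_quad_le (isHermitian_broyd hG hA.isHermitian)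
    (isHermitian_of_nonneg (smul_nonneg (by linarith) hA0)) fun v => ?_
  obtain ⟨ha, hr⟩ := quad_update_pos hA h1 hu
  have key : ∀ w, w ⬝ᵥ (G - A) *ᵥ w ≤ (η - 1) * (w ⬝ᵥ A *ᵥ w) := fun w => by
    simpa [smul_mulVec] using quad_mono hR2 w
  have e := quad_broyd_sub (τ := τ) hA h1 hu v
  have hsr : v ⬝ᵥ (G - A) *ᵥ v - (v ⬝ᵥ (G - A) *ᵥ u) ^ 2 / u ⬝ᵥ (G - A) *ᵥ u
      ≤ (η - 1) * (v ⬝ᵥ A *ᵥ v) := by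
    have := div_nonneg (sq_nonneg (v ⬝ᵥ (G - A) *ᵥ u)) hr.le
    linarith [key v]
  have hdfp := key (v + (-(v ⬝ᵥ A *ᵥ u / u ⬝ᵥ A *ᵥ u)) • u)
  rw [quad_add_smul hA.isHermitian] at hdfp
  have hproj : v ⬝ᵥ A *ᵥ v + 2 * (-(v ⬝ᵥ A *ᵥ u / u ⬝ᵥ A *ᵥ u)) * (v ⬝ᵥ A *ᵥ u)
      + (-(v ⬝ᵥ A *ᵥ u / u ⬝ᵥ A *ᵥ u)) ^ 2 * (u ⬝ᵥ A *ᵥ u) ≤ v ⬝ᵥ A *ᵥ v := by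
    have h3 := div_nonneg (sq_nonneg (v ⬝ᵥ A *ᵥ u)) ha.le
    have h4 : 2 * (-(v ⬝ᵥ A *ᵥ u / u ⬝ᵥ A *ᵥ u)) * (v ⬝ᵥ A *ᵥ u)
      + (-(v ⬝ᵥ A *ᵥ u / u ⬝ᵥ A *ᵥ u)) ^ 2 * (u ⬝ᵥ A *ᵥ u)
        = - ((v ⬝ᵥ A *ᵥ u) ^ 2 / u ⬝ᵥ A *ᵥ u) := by field_simp; ring
    linarith
  have hdfp2 := hdfp.trans (mul_le_mul_of_nonneg_left hproj (by linarith : 0 ≤ η - 1))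
  rw [smul_mulVec, dotProduct_smul, smul_eq_mul]
  have h5 := mul_le_mul_of_nonneg_left hdfp2 hτ.1
  have h6 := mul_le_mul_of_nonneg_left hsr (by linarith [hτ.2] : 0 ≤ 1 - τ)
  linarith

/-- Whatever `τ` is, the update decreases the trace potential at least as much as the DFP update
does. -/
lemma trace_inv_mul_broyd_le (hτ : τ ∈ Set.Icc (0 : ℝ) 1) (hA : A.PosDef) (h1 : A ≤ G) :
    (A⁻¹ * broyd τ G A u).trace
      ≤ (A⁻¹ * G).trace - (u ⬝ᵥ (G - A) *ᵥ u) / (u ⬝ᵥ A *ᵥ u) := by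
  by_cases hu : G *ᵥ u = A *ᵥ u
  · rw [broyd, if_pos hu, sub_mulVec, hu]
    simp
  have hR := sub_nonneg.2 h1
  have hdet := (isUnit_iff_isUnit_det _).1 hA.isUnit
  obtain ⟨ha, hr⟩ := quad_update_pos hA h1 hu
  -- the SR1 update decreases the trace by `‖(G - A) u‖²_{A⁻¹} / (uᵀ (G - A) u)`
  have hsr : (u ⬝ᵥ (G - A) *ᵥ u) / (u ⬝ᵥ A *ᵥ u)
      ≤ (u ⬝ᵥ (G - A) *ᵥ u)⁻¹ * (u ⬝ᵥ ((G - A) * A⁻¹ * (G - A)) *ᵥ u) := by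
    have h3 : u ⬝ᵥ ((G - A) * A⁻¹ * (G - A)) *ᵥ u
        = ((G - A) *ᵥ u) ⬝ᵥ A⁻¹ *ᵥ ((G - A) *ᵥ u) := by
      rw [← mulVec_mulVec, ← mulVec_mulVec,
        dotProduct_mulVec_comm_of_isHermitian (isHermitian_of_nonneg hR), dotProduct_comm]
    have h4 := sq_dotProduct_le_inv_mul hA ((G - A) *ᵥ u) u
    rw [dotProduct_comm _ u] at h4
    rw [h3, div_le_iff₀ ha, mul_assoc, inv_mul_eq_div, le_div_iff₀ hr]
    linarith
  rw [broyd, if_neg hu]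
  simp only [mul_add, mul_sub A⁻¹, Matrix.mul_smul, trace_add, trace_sub, trace_smul, smul_eq_mul,
    trace_mul_mul_vecMulVec_mul]
  rw [mul_assoc G, nonsing_inv_mul _ hdet, mul_one, mul_nonsing_inv _ hdet, one_mul, one_mul]
  have hdfp : (A⁻¹ * G).trace - ((u ⬝ᵥ A *ᵥ u)⁻¹ * (u ⬝ᵥ G *ᵥ u)
        + (u ⬝ᵥ A *ᵥ u)⁻¹ * (u ⬝ᵥ G *ᵥ u))
      + ((u ⬝ᵥ G *ᵥ u) / (u ⬝ᵥ A *ᵥ u) + 1) / (u ⬝ᵥ A *ᵥ u) * (u ⬝ᵥ A *ᵥ u)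
      = (A⁻¹ * G).trace - (u ⬝ᵥ (G - A) *ᵥ u) / (u ⬝ᵥ A *ᵥ u) := by
    rw [sub_mulVec, dotProduct_sub]
    field_simp
    ring
  have h5 := mul_le_mul_of_nonneg_left hsr (by linarith [hτ.2] : 0 ≤ 1 - τ)
  linear_combination τ * hdfp + h5

end Update

/-! ### The norms `‖·‖_A` -/

section MatNorm

open scoped MatrixOrder

variable {d : ℕ} {A B : Matrix (Fin d) (Fin d) ℝ}

lemma matNorm_nonneg (A : Matrix (Fin d) (Fin d) ℝ) (v : Fin d → ℝ) : 0 ≤ matNorm A v :=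
  Real.sqrt_nonneg _

lemma matNorm_sq (hA : 0 ≤ A) (v : Fin d → ℝ) : matNorm A v ^ 2 = v ⬝ᵥ A *ᵥ v :=
  Real.sq_sqrt (quad_nonneg hA v)

lemma matNorm_neg (A : Matrix (Fin d) (Fin d) ℝ) (v : Fin d → ℝ) :
    matNorm A (-v) = matNorm A v := by
  simp [matNorm, mulVec_neg]

lemma matNorm_smul_of_nonneg (A : Matrix (Fin d) (Fin d) ℝ) {t : ℝ} (ht : 0 ≤ t) (v : Fin d → ℝ) :
    matNorm A (t • v) = t * matNorm A v := by
  rw [matNorm, mulVec_smul, dotProduct_smul, smul_dotProduct, smul_smul, smul_eq_mul,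
    Real.sqrt_mul (by positivity), Real.sqrt_mul_self ht, matNorm]

lemma matNorm_add_le (hA : 0 ≤ A) (v w : Fin d → ℝ) :
    matNorm A (v + w) ≤ matNorm A v + matNorm A w := by
  have h := quad_add_smul (isHermitian_of_nonneg hA) v w 1
  rw [one_smul, ← matNorm_sq hA, ← matNorm_sq hA, ← matNorm_sq hA] at h
  have h2 := sq_dotProduct_mulVec_le hA v w
  rw [← matNorm_sq hA, ← matNorm_sq hA, ← mul_pow] at h2
  have h3 := abs_le_of_sq_le_sq h2 (mul_nonneg (matNorm_nonneg A v) (matNorm_nonneg A w))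
  refine abs_le_of_sq_le_sq' (b := matNorm A v + matNorm A w) ?_
    (add_nonneg (matNorm_nonneg _ _) (matNorm_nonneg _ _)) |>.2
  nlinarith [le_abs_self (v ⬝ᵥ A *ᵥ w)]

end MatNorm

/-! ### One quasi-Newton step -/

section Step

open scoped MatrixOrder

variable {d : ℕ} {f : EuclideanSpace ℝ (Fin d) → ℝ} {μ L M : ℝ}

lemma StronglyConvexSmooth.smul_one_le (hs : StronglyConvexSmooth μ L f)
    (x : EuclideanSpace ℝ (Fin d)) : μ • (1 : Matrix (Fin d) (Fin d) ℝ) ≤ hessian f x :=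
  hs.lower x

lemma StronglyConvexSmooth.le_smul_one (hs : StronglyConvexSmooth μ L f)
    (x : EuclideanSpace ℝ (Fin d)) : hessian f x ≤ L • (1 : Matrix (Fin d) (Fin d) ℝ) :=
  hs.upper x

lemma StronglyConvexSmooth.posDef (hs : StronglyConvexSmooth μ L f)
    (x : EuclideanSpace ℝ (Fin d)) : (hessian f x).PosDef :=
  posDef_of_smul_one_le hs.mu_pos (hs.smul_one_le x)

lemma hasDerivAt_dotProduct_gradient_line (hf : TwiceDifferentiable f)
    (x s : EuclideanSpace ℝ (Fin d)) (v : Fin d → ℝ) (t : ℝ) :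
    HasDerivAt (fun t : ℝ => v ⬝ᵥ (gradient f (x + t • s)).ofLp)
      (v ⬝ᵥ hessian f (x + t • s) *ᵥ s.ofLp) t := by
  have h1 : HasDerivAt (fun t : ℝ => x + t • s) s t := by
    simpa using ((hasDerivAt_id t).smul_const s).const_add x
  have h2 : HasDerivAt (fun t : ℝ => gradient f (x + t • s))
      (fderiv ℝ (gradient f) (x + t • s) s) t :=
    HasFDerivAt.comp_hasDerivAt (l := gradient f) (f := fun t : ℝ => x + t • s) t
      (hf.2 (x + t • s)).hasFDerivAt h1
  have h3 : hessian f (x + t • s) *ᵥ s.ofLp = (fderiv ℝ (gradient f) (x + t • s) s).ofLp := by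
    have hsum : s = ∑ j, s j • EuclideanSpace.single j (1 : ℝ) := by
      ext i
      simp [Finset.sum_apply, Pi.single_apply]
    ext i
    simp only [mulVec, dotProduct, hessian, of_apply]
    generalize fderiv ℝ (gradient f) (x + t • s) = T
    conv_rhs => rw [hsum, map_sum]
    simp [mul_comm]
  rw [h3]
  have h4 : ∀ i, HasDerivAt (fun t : ℝ => (gradient f (x + t • s)).ofLp i)
      ((fderiv ℝ (gradient f) (x + t • s) s).ofLp i) t := fun i =>
    ((EuclideanSpace.proj (𝕜 := ℝ) i).hasFDerivAt.comp_hasDerivAt t h2)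
  simp only [dotProduct]
  exact HasDerivAt.fun_sum fun i _ => (h4 i).const_mul (v i)

lemma StronglySelfConcordant.sub_le (hc : StronglySelfConcordant M f)
    (x y z w : EuclideanSpace ℝ (Fin d)) :
    hessian f y - hessian f x ≤ (M * matNorm (hessian f z) (y - x).ofLp) • hessian f w :=
  hc.bound x y z w

lemma StronglySelfConcordant.hessian_le (hc : StronglySelfConcordant M f)
    (x y : EuclideanSpace ℝ (Fin d)) :
    hessian f y ≤ (1 + M * matNorm (hessian f x) (y - x).ofLp) • hessian f x := by
  rw [add_smul, one_smul, add_comm]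
  exact sub_le_iff_le_add.1 (hc.sub_le x y x x)

lemma StronglySelfConcordant.le_hessian (hc : StronglySelfConcordant M f)
    (x y : EuclideanSpace ℝ (Fin d)) :
    hessian f x ≤ (1 + M * matNorm (hessian f x) (y - x).ofLp) • hessian f y := by
  have h := hc.sub_le y x x y
  rw [← neg_sub y x, WithLp.ofLp_neg, matNorm_neg] at h
  rw [add_smul, one_smul, add_comm]
  exact sub_le_iff_le_add.1 h

lemma StronglySelfConcordant.abs_quad_sub_le (hc : StronglySelfConcordant M f)
    (x y : EuclideanSpace ℝ (Fin d)) (v : Fin d → ℝ) :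
    |v ⬝ᵥ (hessian f y - hessian f x) *ᵥ v|
      ≤ M * matNorm (hessian f x) (y - x).ofLp * (v ⬝ᵥ hessian f x *ᵥ v) := by
  have h1 := quad_mono (hc.sub_le x y x x) v
  have h2 := quad_mono (hc.sub_le y x x x) v
  rw [← neg_sub y x, WithLp.ofLp_neg, matNorm_neg] at h2
  simp only [smul_mulVec, dotProduct_smul, smul_eq_mul, sub_mulVec, dotProduct_sub] at h1 h2 ⊢
  rw [abs_le]
  constructor <;> linarith

/-- Along a segment the gradient differs from its first order expansion by at most `M r² / 2` in the
dual norm. The bound is proved by testing against a fixed vector and comparing derivatives, which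
needs no integral of the Hessian. -/
lemma matNorm_inv_gradient_sub_le (hs : StronglyConvexSmooth μ L f)
    (hc : StronglySelfConcordant M f) (x s : EuclideanSpace ℝ (Fin d)) :
    matNorm (hessian f x)⁻¹
        ((gradient f (x + s)).ofLp - (gradient f x).ofLp - hessian f x *ᵥ s.ofLp)
      ≤ M / 2 * matNorm (hessian f x) s.ofLp ^ 2 := by
  set H := hessian f x with hH
  have hpd : H.PosDef := hs.posDef x
  have hH0 := nonneg_of_posDef hpd
  set e := (gradient f (x + s)).ofLp - (gradient f x).ofLp - H *ᵥ s.ofLp with he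
  set r := matNorm H s.ofLp with hr
  have hr0 : 0 ≤ r := matNorm_nonneg _ _
  set v := H⁻¹ *ᵥ e with hv
  set p := matNorm H v with hp
  have hp0 : 0 ≤ p := matNorm_nonneg _ _
  have hpe : v ⬝ᵥ e = p ^ 2 := by
    rw [hp, matNorm_sq hH0, hv, mulVec_inv_mulVec hpd]
  have hpn : matNorm H⁻¹ e = p := by
    rw [← Real.sqrt_sq hp0, ← hpe, matNorm, ← hv, dotProduct_comm]
  -- the derivative of `t ↦ vᵀ (∇f (x + t s) - t H s)` is at most `M t r² ‖v‖_H`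
  have hder : ∀ t : ℝ, 0 ≤ t →
      v ⬝ᵥ hessian f (x + t • s) *ᵥ s.ofLp - v ⬝ᵥ H *ᵥ s.ofLp ≤ M * t * r ^ 2 * p := by
    intro t ht
    have e1 : (x + t • s - x).ofLp = t • s.ofLp := by simp
    have h1 := sq_dotProduct_mulVec_le_of_abs_le
      ((hs.posDef (x + t • s)).isHermitian.sub hpd.isHermitian) hpd.isHermitian
      (fun w => hc.abs_quad_sub_le x (x + t • s) w) v s.ofLp
    rw [e1, matNorm_smul_of_nonneg _ ht, ← hH, ← hr, ← matNorm_sq hH0, ← matNorm_sq hH0, ← hp,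
      ← hr, sub_mulVec, dotProduct_sub, ← mul_pow, ← mul_pow] at h1
    have hM := hc.M_pos
    have h2 := (abs_le_of_sq_le_sq' h1 (by positivity)).2
    linarith
  let ψ : ℝ → ℝ := fun t => v ⬝ᵥ (gradient f (x + t • s)).ofLp - t * (v ⬝ᵥ H *ᵥ s.ofLp)
    - M / 2 * r ^ 2 * p * t ^ 2
  have hψ : ∀ t, HasDerivAt ψ (v ⬝ᵥ hessian f (x + t • s) *ᵥ s.ofLp - v ⬝ᵥ H *ᵥ s.ofLp
      - M * t * r ^ 2 * p) t := fun t => by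
    have h1 := ((hasDerivAt_dotProduct_gradient_line hs.twiceDifferentiable x s v t).sub
      ((hasDerivAt_id t).mul_const (v ⬝ᵥ H *ᵥ s.ofLp))).sub
      ((hasDerivAt_pow 2 t).const_mul (M / 2 * r ^ 2 * p))
    refine h1.congr_deriv ?_
    simp only [Nat.cast_ofNat, one_mul, pow_one, Nat.add_one_sub_one]
    ring
  have hanti : AntitoneOn ψ (Set.Icc 0 1) := by
    refine antitoneOn_of_deriv_nonpos (convex_Icc 0 1)
      (fun t _ => (hψ t).continuousAt.continuousWithinAt)
      (fun t _ => (hψ t).differentiableAt.differentiableWithinAt) fun t ht => ?_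
    rw [interior_Icc] at ht
    rw [(hψ t).deriv]
    linarith [hder t ht.1.le]
  have h01 := hanti (Set.left_mem_Icc.2 zero_le_one) (Set.right_mem_Icc.2 zero_le_one) zero_le_one
  have h2 : p ^ 2 ≤ M / 2 * r ^ 2 * p := by
    rw [← hpe, he, dotProduct_sub, dotProduct_sub]
    simp only [ψ, one_smul, zero_smul, add_zero] at h01
    linarith
  rw [hpn]
  rcases hp0.eq_or_lt with h | h
  · rw [← h]
    have hM := hc.M_pos
    positivity
  · exact le_of_mul_le_mul_right (by linarith) h

variable {G : Matrix (Fin d) (Fin d) ℝ} {x : EuclideanSpace ℝ (Fin d)} {η : ℝ}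

lemma newtonStep_sub (f : EuclideanSpace ℝ (Fin d) → ℝ) (x : EuclideanSpace ℝ (Fin d))
    (G : Matrix (Fin d) (Fin d) ℝ) :
    (newtonStep f x G - x).ofLp = -(G⁻¹ *ᵥ (gradient f x).ofLp) := by
  simp [newtonStep]

lemma matNorm_newtonStep_sub_le (hs : StronglyConvexSmooth μ L f) (h1 : hessian f x ≤ G) :
    matNorm (hessian f x) (newtonStep f x G - x).ofLp ≤ lambda f x := by
  have hH := hs.posDef x
  have hG := posDef_of_le hH h1
  rw [newtonStep_sub, matNorm_neg]
  refine Real.sqrt_le_sqrt ((quad_mono h1 _).trans ?_)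
  rw [mulVec_inv_mulVec hG, dotProduct_comm]
  simpa using inv_quad_le_of_le_smul (c := 1) hH hG (by simpa using h1) (gradient f x).ofLp

/-- Contraction of `λ_f` in one step: the relative error `η` of the Hessian approximation gives the
factor `1 - 1/η`, and self-concordance contributes corrections of the order of `M λ_f(x)`. -/
lemma lambda_newtonStep_le (hs : StronglyConvexSmooth μ L f) (hc : StronglySelfConcordant M f)
    (hη : 1 ≤ η) (h1 : hessian f x ≤ G) (h2 : G ≤ η • hessian f x) :
    lambda f (newtonStep f x G)
      ≤ (1 + M * lambda f x / 2) * (1 - 1 / η + M * lambda f x / 2) * lambda f x := by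
  set y := newtonStep f x G with hy
  have hH := hs.posDef x
  have hH' := hs.posDef y
  have hG := posDef_of_le hH h1
  have hM := hc.M_pos
  set H := hessian f x with hHdef
  set g := (gradient f x).ofLp with hg
  set s := y - x with hsdef
  have hs' : s.ofLp = -(G⁻¹ *ᵥ g) := newtonStep_sub f x G
  have hGs : G *ᵥ s.ofLp = -g := by rw [hs', mulVec_neg, mulVec_inv_mulVec hG]
  set r := matNorm H s.ofLp with hr
  have hr0 : 0 ≤ r := matNorm_nonneg _ _
  have hrl : r ≤ lambda f x := matNorm_newtonStep_sub_le hs h1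
  set l := lambda f x with hl
  have hl0 : 0 ≤ l := hr0.trans hrl
  have hη' : 0 ≤ 1 - 1 / η := by
    rw [sub_nonneg, div_le_one (by linarith)]; exact hη
  have hA : matNorm H⁻¹ ((G - H) *ᵥ s.ofLp) ≤ (1 - 1 / η) * l := by
    have h := quad_inv_sub_mulVec_le hη hH h1 h2 s.ofLp
    rw [← matNorm_sq (nonneg_of_posDef hH.inv), ← matNorm_sq (nonneg_of_posDef hH.inv), hGs,
      matNorm_neg, ← mul_pow] at h
    exact (abs_le_of_sq_le_sq' h (mul_nonneg hη' hl0)).2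
  have hB := matNorm_inv_gradient_sub_le hs hc x s
  rw [← hHdef, ← hg, ← hr, show x + s = y by rw [hsdef]; abel] at hB
  have hC : (gradient f y).ofLp
      = ((gradient f y).ofLp - g - H *ᵥ s.ofLp) + -((G - H) *ᵥ s.ofLp) := by
    rw [sub_mulVec, hGs]; abel
  have hD : matNorm H⁻¹ (gradient f y).ofLp ≤ (1 - 1 / η + M * l / 2) * l := by
    rw [hC]
    refine (matNorm_add_le (nonneg_of_posDef hH.inv) _ _).trans ?_
    rw [matNorm_neg]
    have : M / 2 * r ^ 2 ≤ M / 2 * l ^ 2 := by gcongr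
    nlinarith
  have hE : lambda f y ≤ (1 + M * r / 2) * matNorm H⁻¹ (gradient f y).ofLp := by
    have h := inv_quad_le_of_le_smul hH hH' (hc.le_hessian x y) (gradient f y).ofLp
    rw [← hHdef, ← hsdef, ← hr] at h
    refine Real.sqrt_le_iff.2 ⟨mul_nonneg (by positivity) (matNorm_nonneg _ _), h.trans ?_⟩
    rw [mul_pow, matNorm_sq (nonneg_of_posDef hH.inv)]
    refine mul_le_mul_of_nonneg_right ?_ (quad_nonneg (nonneg_of_posDef hH.inv) _)
    nlinarith [sq_nonneg (M * r)]
  refine hE.trans ?_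
  rw [mul_assoc]
  exact mul_le_mul (by gcongr) hD (matNorm_nonneg _ _) (by positivity)

end Step

/-! ### Invariants of the iterates -/

section Invariants

open scoped MatrixOrder

variable {d : ℕ} {f : EuclideanSpace ℝ (Fin d) → ℝ} {μ L M : ℝ}

/-- The contraction factor of `λ_f` that holds along every run of the method. It is slightly better
than `1 - 1/(2κ)`; the gap pays for the cross term in the recursion for the trace potential. -/
noncomputable def linearRate (κ : ℝ) : ℝ := 1 - 13 / (24 * κ)

/-- A deterministic upper bound for `M λ_f(x_k)`. -/
noncomputable def lambdaBound (κ : ℝ) (k : ℕ) : ℝ := Real.log (3 / 2) / (4 * κ) * linearRate κ ^ k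

/-- The trace potential `tr(∇²f(x)⁻¹ (G - ∇²f(x)))` of a pair `(x, G)`. -/
noncomputable def potential (f : EuclideanSpace ℝ (Fin d) → ℝ)
    (p : EuclideanSpace ℝ (Fin d) × Matrix (Fin d) (Fin d) ℝ) : ℝ :=
  ((hessian f p.1)⁻¹ * p.2).trace - d

/-- The corrected matrix `(1 + M r) G` that enters the update at `(x, G)`. -/
noncomputable def corrected (f : EuclideanSpace ℝ (Fin d) → ℝ) (M : ℝ)
    (p : EuclideanSpace ℝ (Fin d) × Matrix (Fin d) (Fin d) ℝ) : Matrix (Fin d) (Fin d) ℝ :=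
  (1 + M * matNorm (hessian f p.1) (newtonStep f p.1 p.2 - p.1).ofLp) • p.2

/-- The error `(1 + M r) G - ∇²f(x₊)` of the corrected matrix at the next point, before the
update. -/
noncomputable def residual (f : EuclideanSpace ℝ (Fin d) → ℝ) (M : ℝ)
    (p : EuclideanSpace ℝ (Fin d) × Matrix (Fin d) (Fin d) ℝ) : Matrix (Fin d) (Fin d) ℝ :=
  corrected f M p - hessian f (newtonStep f p.1 p.2)

lemma linearRate_pos {κ : ℝ} (hκ : 1 ≤ κ) : 0 < linearRate κ := by
  rw [linearRate, sub_pos, div_lt_one (by positivity)]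
  linarith

lemma linearRate_le_one {κ : ℝ} (hκ : 1 ≤ κ) : linearRate κ ≤ 1 := by
  have : 0 ≤ 13 / (24 * κ) := by positivity
  rw [linearRate]; linarith

lemma log_three_halves_pos : 0 < Real.log (3 / 2) := Real.log_pos (by norm_num)

lemma log_three_halves_le : Real.log (3 / 2) ≤ 1 / 2 := by
  have := Real.log_le_sub_one_of_pos (by norm_num : (0 : ℝ) < 3 / 2)
  linarith

lemma lambdaBound_nonneg {κ : ℝ} (hκ : 1 ≤ κ) (k : ℕ) : 0 ≤ lambdaBound κ k :=
  mul_nonneg (div_nonneg log_three_halves_pos.le (by positivity))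
    (pow_nonneg (linearRate_pos hκ).le _)

lemma lambdaBound_succ (κ : ℝ) (k : ℕ) :
    lambdaBound κ (k + 1) = linearRate κ * lambdaBound κ k := by
  rw [lambdaBound, lambdaBound, pow_succ]; ring

lemma lambdaBound_le {κ : ℝ} (hκ : 1 ≤ κ) (k : ℕ) :
    lambdaBound κ k ≤ 1 / (8 * κ) * linearRate κ ^ k := by
  refine mul_le_mul_of_nonneg_right ?_ (pow_nonneg (linearRate_pos hκ).le _)
  rw [div_le_div_iff₀ (by positivity) (by positivity)]
  nlinarith [log_three_halves_le]

lemma lambdaBound_le_const {κ : ℝ} (hκ : 1 ≤ κ) (k : ℕ) : lambdaBound κ k ≤ 1 / (8 * κ) :=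
  (lambdaBound_le hκ k).trans
    (mul_le_of_le_one_right (by positivity)
      (pow_le_one₀ (linearRate_pos hκ).le (linearRate_le_one hκ)))

/-- The accumulated correction factors stay below `3/2`, because `∑ M λ_f(x_k) ≤ ln(3/2) / 2`. -/
lemma exp_sum_lambdaBound_le {κ : ℝ} (hκ : 1 ≤ κ) (k : ℕ) :
    Real.exp (2 * ∑ i ∈ Finset.range k, lambdaBound κ i) ≤ 3 / 2 := by
  have hq := linearRate_pos hκ
  have hq1 : linearRate κ < 1 := by
    rw [linearRate]
    have : 0 < 13 / (24 * κ) := by positivity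
    linarith
  have hgeom : ∑ i ∈ Finset.range k, linearRate κ ^ i ≤ 2 * κ := by
    have h := (summable_geometric_of_lt_one hq.le hq1).sum_le_tsum (Finset.range k)
      fun i _ => pow_nonneg hq.le i
    rw [tsum_geometric_of_lt_one hq.le hq1] at h
    refine h.trans ?_
    rw [linearRate, sub_sub_cancel, inv_div, div_le_iff₀ (by norm_num)]
    linarith
  rw [← Real.le_log_iff_exp_le (by norm_num)]
  simp only [lambdaBound]
  rw [← Finset.mul_sum]
  have hlog := log_three_halves_pos
  calc 2 * (Real.log (3 / 2) / (4 * κ) * ∑ i ∈ Finset.range k, linearRate κ ^ i)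
      ≤ 2 * (Real.log (3 / 2) / (4 * κ) * (2 * κ)) := by gcongr
    _ = Real.log (3 / 2) := by field_simp; norm_num

lemma contraction_factor_le {κ η m : ℝ} (hκ : 1 ≤ κ) (hη : 1 ≤ η) (hη' : η ≤ 3 / 2 * κ)
    (hm0 : 0 ≤ m) (hm : m ≤ 1 / (8 * κ)) :
    (1 + m / 2) * (1 - 1 / η + m / 2) ≤ linearRate κ := by
  have hκ0 : 0 < κ := by linarith
  obtain ⟨t, ht⟩ : ∃ t, t = 1 / κ := ⟨_, rfl⟩
  have ht0 : 0 < t := by rw [ht]; positivity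
  have hm' : m ≤ t / 8 := by rw [ht]; convert hm using 1; field_simp
  have hη2 : 2 / 3 * t ≤ 1 / η := by
    rw [ht, le_div_iff₀ (by linarith), mul_one_div, div_mul_eq_mul_div, div_le_one hκ0]
    linarith
  have hη3 : 0 ≤ 1 - 1 / η := by rw [sub_nonneg, div_le_one (by linarith)]; exact hη
  have hr : linearRate κ = 1 - 13 / 24 * t := by rw [linearRate, ht]; field_simp
  rw [hr]
  calc (1 + m / 2) * (1 - 1 / η + m / 2) ≤ (1 + t / 16) * (1 - 2 / 3 * t + t / 16) := by
        apply mul_le_mul <;> linarith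
    _ ≤ 1 - 13 / 24 * t := by nlinarith

lemma one_le_of_stronglyConvexSmooth [NeZero d] (hs : StronglyConvexSmooth μ L f) : 1 ≤ L / μ := by
  have h := quad_mono ((hs.smul_one_le 0).trans (hs.le_smul_one 0)) (Pi.single 0 1)
  simp only [smul_mulVec, one_mulVec, dotProduct_smul, smul_eq_mul, single_dotProduct,
    Pi.single_eq_same, mul_one] at h
  rwa [one_le_div hs.mu_pos]

section PairBounds

variable {p : EuclideanSpace ℝ (Fin d) × Matrix (Fin d) (Fin d) ℝ} {η m : ℝ}

lemma lambda_nonneg (f : EuclideanSpace ℝ (Fin d) → ℝ) (x : EuclideanSpace ℝ (Fin d)) :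
    0 ≤ lambda f x := matNorm_nonneg _ _

lemma hessian_le_corrected (hc : StronglySelfConcordant M f)
    (h1 : hessian f p.1 ≤ p.2) : hessian f (newtonStep f p.1 p.2) ≤ corrected f M p := by
  have hM := hc.M_pos
  have := matNorm_nonneg (hessian f p.1) (newtonStep f p.1 p.2 - p.1).ofLp
  exact (hc.hessian_le p.1 _).trans (smul_le_smul_of_nonneg_left h1 (by positivity))

lemma corrected_le_smul (hs : StronglyConvexSmooth μ L f) (hc : StronglySelfConcordant M f)
    (h1 : hessian f p.1 ≤ p.2) (hη : 1 ≤ η) (h2 : p.2 ≤ η • hessian f p.1)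
    (hm : M * lambda f p.1 ≤ m) :
    corrected f M p ≤ ((1 + m) ^ 2 * η) • hessian f (newtonStep f p.1 p.2) := by
  have hM := hc.M_pos
  have hr0 := matNorm_nonneg (hessian f p.1) (newtonStep f p.1 p.2 - p.1).ofLp
  have hrl := matNorm_newtonStep_sub_le hs h1
  have hy := nonneg_of_posDef (hs.posDef (newtonStep f p.1 p.2))
  have h3 := hc.le_hessian p.1 (newtonStep f p.1 p.2)
  rw [corrected]
  set r := matNorm (hessian f p.1) (newtonStep f p.1 p.2 - p.1).ofLp
  have hrm : M * r ≤ m := (mul_le_mul_of_nonneg_left hrl hM.le).trans hm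
  calc (1 + M * r) • p.2 ≤ (1 + M * r) • η • (1 + M * r) • hessian f (newtonStep f p.1 p.2) := by
        refine smul_le_smul_of_nonneg_left (h2.trans ?_) (by positivity)
        exact smul_le_smul_of_nonneg_left h3 (by linarith)
    _ = ((1 + M * r) ^ 2 * η) • hessian f (newtonStep f p.1 p.2) := by
        rw [smul_smul, smul_smul]; congr 1; ring
    _ ≤ _ := by
        refine smul_le_smul_of_nonneg_right ?_ hy
        have : 0 ≤ M * r := by positivity
        gcongr

lemma residual_nonneg (hc : StronglySelfConcordant M f)
    (h1 : hessian f p.1 ≤ p.2) : 0 ≤ residual f M p :=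
  sub_nonneg.2 (hessian_le_corrected hc h1)

lemma trace_inv_hessian_mul_self (hs : StronglyConvexSmooth μ L f) (x : EuclideanSpace ℝ (Fin d)) :
    ((hessian f x)⁻¹ * hessian f x).trace = d := by
  rw [nonsing_inv_mul _ ((isUnit_iff_isUnit_det _).1 (hs.posDef x).isUnit), trace_one,
    Fintype.card_fin]

lemma potential_eq (hs : StronglyConvexSmooth μ L f) :
    potential f p = ((hessian f p.1)⁻¹ * (p.2 - hessian f p.1)).trace := by
  rw [mul_sub, trace_sub, trace_inv_hessian_mul_self hs, potential]

lemma potential_nonneg (hs : StronglyConvexSmooth μ L f) (h1 : hessian f p.1 ≤ p.2) :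
    0 ≤ potential f p := by
  rw [potential_eq hs]
  exact trace_mul_nonneg (nonneg_of_posDef (hs.posDef _).inv) (sub_nonneg.2 h1)

lemma potential_le (hs : StronglyConvexSmooth μ L f) (h2 : p.2 ≤ η • hessian f p.1) :
    potential f p ≤ d * (η - 1) := by
  have := trace_mul_mono_right (nonneg_of_posDef (hs.posDef p.1).inv) h2
  rw [Matrix.mul_smul, trace_smul, trace_inv_hessian_mul_self hs, smul_eq_mul] at this
  rw [potential]
  linarith

/-- The potential controls the relative error of the Hessian approximation, hence the contraction
of `λ_f`. -/
lemma lambda_newtonStep_le_potential (hs : StronglyConvexSmooth μ L f)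
    (hc : StronglySelfConcordant M f) (h1 : hessian f p.1 ≤ p.2) (hm : M * lambda f p.1 ≤ m) :
    lambda f (newtonStep f p.1 p.2) ≤ (1 + m / 2) * (potential f p + m / 2) * lambda f p.1 := by
  have hσ := potential_nonneg hs h1
  have h2 : p.2 ≤ (1 + potential f p) • hessian f p.1 := by
    rw [add_smul, one_smul, add_comm, ← sub_le_iff_le_add, potential_eq hs]
    exact le_trace_smul (hs.posDef _) (sub_nonneg.2 h1)
  have hl := lambda_nonneg f p.1
  have hM := hc.M_pos
  have hml : 0 ≤ M * lambda f p.1 := by positivity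
  refine (lambda_newtonStep_le hs hc (by linarith) h1 h2).trans ?_
  have h3 : 1 - 1 / (1 + potential f p) ≤ potential f p := by
    rw [one_sub_div (by linarith), div_le_iff₀ (by linarith)]
    nlinarith
  have h4 : 0 ≤ 1 - 1 / (1 + potential f p) := by
    rw [sub_nonneg, div_le_one (by linarith)]; linarith
  have hm0 : 0 ≤ m := hml.trans hm
  gcongr

/-- Growth of the potential under the change of the base point and the correction of `G`. -/
lemma trace_inv_hessian_mul_residual_le (hs : StronglyConvexSmooth μ L f)
    (hc : StronglySelfConcordant M f) (h1 : hessian f p.1 ≤ p.2) (hm : M * lambda f p.1 ≤ m) :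
    ((hessian f (newtonStep f p.1 p.2))⁻¹ * residual f M p).trace
      ≤ (1 + m) ^ 2 * (potential f p + 2 * d * m) := by
  have hM := hc.M_pos
  have hG0 : 0 ≤ p.2 := (nonneg_of_posDef (hs.posDef p.1)).trans h1
  have hr0 := matNorm_nonneg (hessian f p.1) (newtonStep f p.1 p.2 - p.1).ofLp
  have hrl := matNorm_newtonStep_sub_le hs h1
  have h3 := trace_mul_mono hG0 (inv_quad_le_of_le_smul (hs.posDef p.1)
    (hs.posDef (newtonStep f p.1 p.2)) (hc.le_hessian p.1 (newtonStep f p.1 p.2)))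
  have hσ := potential_nonneg hs h1
  rw [residual, mul_sub, trace_sub, trace_inv_hessian_mul_self hs, corrected, Matrix.mul_smul,
    trace_smul, smul_eq_mul]
  set r := matNorm (hessian f p.1) (newtonStep f p.1 p.2 - p.1).ofLp
  have hrm : M * r ≤ m := (mul_le_mul_of_nonneg_left hrl hM.le).trans hm
  have hr1 : 0 ≤ M * r := by positivity
  have hm0 : 0 ≤ m := hr1.trans hrm
  have e : ((hessian f p.1)⁻¹ * p.2).trace = potential f p + d := by rw [potential]; ring
  rw [e] at h3
  have hd : (0 : ℝ) ≤ d := Nat.cast_nonneg d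
  have h4 := mul_le_mul_of_nonneg_left h3 (by linarith : 0 ≤ 1 + M * r)
  have h5 : (1 + M * r) * ((1 + M * r) * (potential f p + d))
      ≤ (1 + m) ^ 2 * (potential f p + d) := by
    rw [← mul_assoc, ← sq]
    gcongr
  -- the correction term `2 d m` absorbs the growth of the constant `d`: `(1 + m)² (1 - 2m) ≤ 1`
  have h6 : (d : ℝ) * ((1 + m) ^ 2 * (1 - 2 * m)) ≤ d * 1 := by
    refine mul_le_mul_of_nonneg_left ?_ hd
    nlinarith [pow_nonneg hm0 3, sq_nonneg m]
  linarith

/-- One update decreases the potential by at least `uᵀ R u / (L uᵀ u)`. -/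
lemma potential_broyd_le (hs : StronglyConvexSmooth μ L f) (hc : StronglySelfConcordant M f)
    (h1 : hessian f p.1 ≤ p.2) {τ : ℝ} (hτ : τ ∈ Set.Icc (0 : ℝ) 1) (u : Fin d → ℝ) :
    potential f (newtonStep f p.1 p.2,
        broyd τ (corrected f M p) (hessian f (newtonStep f p.1 p.2)) u)
      ≤ ((hessian f (newtonStep f p.1 p.2))⁻¹ * residual f M p).trace
        - (u ⬝ᵥ residual f M p *ᵥ u) / (u ⬝ᵥ u) / L := by
  have h := trace_inv_mul_broyd_le (u := u) hτ (hs.posDef (newtonStep f p.1 p.2))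
    (hessian_le_corrected hc h1)
  have hR := quad_nonneg (residual_nonneg hc h1) u
  rw [potential]
  have e : ((hessian f (newtonStep f p.1 p.2))⁻¹ * residual f M p).trace
      = ((hessian f (newtonStep f p.1 p.2))⁻¹ * corrected f M p).trace - d := by
    rw [residual, mul_sub, trace_sub, trace_inv_hessian_mul_self hs]
  rw [e]
  change _ ≤ _ - (u ⬝ᵥ residual f M p *ᵥ u) / _ at h
  have h3 : (u ⬝ᵥ residual f M p *ᵥ u) / (u ⬝ᵥ u) / L
      ≤ (u ⬝ᵥ residual f M p *ᵥ u) / (u ⬝ᵥ hessian f (newtonStep f p.1 p.2) *ᵥ u) := by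
    by_cases hu : u = 0
    · simp [hu]
    rw [div_div]
    refine div_le_div_of_nonneg_left hR (quad_pos (hs.posDef _) hu) ?_
    simpa [smul_mulVec, mul_comm] using quad_mono (hs.le_smul_one (newtonStep f p.1 p.2)) u
  dsimp only
  linarith

lemma mul_trace_inv_hessian_mul_residual_le (hs : StronglyConvexSmooth μ L f)
    (hc : StronglySelfConcordant M f) (h1 : hessian f p.1 ≤ p.2) :
    μ * ((hessian f (newtonStep f p.1 p.2))⁻¹ * residual f M p).trace
      ≤ (residual f M p).trace := by
  have hμ := hs.mu_pos
  have h := trace_mul_mono (A := (hessian f (newtonStep f p.1 p.2))⁻¹) (B := 1) (c := μ⁻¹)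
    (residual_nonneg hc h1) fun v => by
      have := inv_quad_le_of_le_smul (c := μ⁻¹) PosDef.one (hs.posDef (newtonStep f p.1 p.2)) (by
        have := smul_le_smul_of_nonneg_left (hs.smul_one_le (newtonStep f p.1 p.2))
          (inv_nonneg.2 hμ.le)
        rwa [smul_smul, inv_mul_cancel₀ hμ.ne', one_smul] at this) v
      rwa [inv_one] at this
  rw [one_mul] at h
  calc _ ≤ μ * (μ⁻¹ * (residual f M p).trace) := by gcongr
    _ = _ := by field_simp

/-- The entries of a matrix between `0` and `c I` are bounded by `c`. -/
lemma abs_apply_le_of_le_smul_one {R : Matrix (Fin d) (Fin d) ℝ} {c : ℝ} (hR : 0 ≤ R)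
    (h : R ≤ c • (1 : Matrix (Fin d) (Fin d) ℝ)) (i j : Fin d) : |R i j| ≤ c := by
  have hdiag : ∀ i, 0 ≤ R i i ∧ R i i ≤ c := fun i => by
    have h1 := quad_nonneg hR (Pi.single i 1)
    have h2 := quad_mono h (Pi.single i 1)
    simp only [single_dotProduct, one_mul, mulVec_single_one, col_apply] at h1 h2
    rw [Matrix.smul_apply, one_apply_eq, smul_eq_mul, mul_one] at h2
    exact ⟨h1, h2⟩
  have h3 := sq_dotProduct_mulVec_le hR (Pi.single i 1) (Pi.single j 1)
  simp only [single_dotProduct, one_mul, mulVec_single_one, col_apply] at h3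
  have hc := (hdiag i).1.trans (hdiag i).2
  refine abs_le_of_sq_le_sq (h3.trans ?_) hc
  rw [sq]
  exact mul_le_mul (hdiag i).2 (hdiag j).2 (hdiag j).1 hc

end PairBounds

lemma iterates_succ (x₀ : EuclideanSpace ℝ (Fin d)) (u : ℕ → EuclideanSpace ℝ (Fin d))
    (τ : ℕ → ℝ) (k : ℕ) :
    iterates f M L x₀ u τ (k + 1)
      = (newtonStep f (iterates f M L x₀ u τ k).1 (iterates f M L x₀ u τ k).2,
        broyd (τ k) (corrected f M (iterates f M L x₀ u τ k))
          (hessian f (newtonStep f (iterates f M L x₀ u τ k).1 (iterates f M L x₀ u τ k).2))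
          (u k).ofLp) := rfl

/-- The bounds that hold along every run of the method: `G_k` dominates the Hessian and is within
a factor `κ exp(2 ∑_{i<k} m_i) ≤ 3κ/2` of it, with `m_i` the bound for `M λ_f(x_i)`, and
`λ_f(x_k)` decreases linearly. -/
structure IteratesBounds (f : EuclideanSpace ℝ (Fin d) → ℝ) (M κ : ℝ)
    (x₀ : EuclideanSpace ℝ (Fin d)) (k : ℕ)
    (p : EuclideanSpace ℝ (Fin d) × Matrix (Fin d) (Fin d) ℝ) : Prop where
  hessian_le : hessian f p.1 ≤ p.2
  le_smul : p.2 ≤ (κ * Real.exp (2 * ∑ i ∈ Finset.range k, lambdaBound κ i)) • hessian f p.1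
  mul_lambda_le : M * lambda f p.1 ≤ lambdaBound κ k
  lambda_le : lambda f p.1 ≤ linearRate κ ^ k * lambda f x₀

lemma iteratesBounds [NeZero d] (hs : StronglyConvexSmooth μ L f) (hc : StronglySelfConcordant M f)
    {x₀ : EuclideanSpace ℝ (Fin d)}
    (h0 : M * lambda f x₀ ≤ Real.log (3 / 2) / (4 * (L / μ)))
    (u : ℕ → EuclideanSpace ℝ (Fin d)) {τ : ℕ → ℝ} (hτ : ∀ k, τ k ∈ Set.Icc (0 : ℝ) 1) (k : ℕ) :
    IteratesBounds f M (L / μ) x₀ k (iterates f M L x₀ u τ k) := by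
  have hκ := one_le_of_stronglyConvexSmooth hs
  induction k with
  | zero =>
    refine ⟨hs.le_smul_one x₀, ?_, by simpa [lambdaBound, iterates] using h0, by simp [iterates]⟩
    have := smul_le_smul_of_nonneg_left (hs.smul_one_le x₀) (zero_le_one.trans hκ)
    rw [smul_smul, div_mul_cancel₀ _ hs.mu_pos.ne'] at this
    simpa [iterates] using this
  | succ k ih =>
    rw [iterates_succ]
    set p := iterates f M L x₀ u τ k
    set κ := L / μ
    set η := κ * Real.exp (2 * ∑ i ∈ Finset.range k, lambdaBound κ i) with hη
    have hsum : 0 ≤ ∑ i ∈ Finset.range k, lambdaBound κ i :=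
      Finset.sum_nonneg fun i _ => lambdaBound_nonneg hκ i
    have hη1 : 1 ≤ η := one_le_mul_of_one_le_of_one_le hκ (Real.one_le_exp (by positivity))
    have hη2 : η ≤ 3 / 2 * κ := by
      rw [hη, mul_comm]
      exact mul_le_mul_of_nonneg_right (exp_sum_lambdaBound_le hκ k) (by linarith)
    have hM := hc.M_pos
    have hl := lambda_nonneg f p.1
    have hle := hessian_le_corrected hc ih.hessian_le
    have hm0 := lambdaBound_nonneg hκ k
    have hcon : lambda f (newtonStep f p.1 p.2) ≤ linearRate κ * lambda f p.1 :=
      (lambda_newtonStep_le hs hc hη1 ih.hessian_le ih.le_smul).trans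
        (mul_le_mul_of_nonneg_right (contraction_factor_le hκ hη1 hη2 (by positivity)
          (ih.mul_lambda_le.trans (lambdaBound_le_const hκ k))) hl)
    refine ⟨le_broyd (hτ k) (hs.posDef _) hle, ?_, ?_, ?_⟩
    · have hcor := corrected_le_smul hs hc ih.hessian_le hη1 ih.le_smul ih.mul_lambda_le
      have h1 : (1 : ℝ) ≤ (1 + lambdaBound κ k) ^ 2 * η :=
        one_le_mul_of_one_le_of_one_le (one_le_pow₀ (by linarith)) hη1
      refine (broyd_le_smul (hτ k) h1 (hs.posDef _) hle hcor).trans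
        (smul_le_smul_of_nonneg_right ?_ (nonneg_of_posDef (hs.posDef _)))
      rw [Finset.sum_range_succ, mul_add, Real.exp_add, hη, mul_comm, mul_assoc]
      have h2 : (1 + lambdaBound κ k) ^ 2 ≤ Real.exp (2 * lambdaBound κ k) := by
        rw [two_mul, Real.exp_add, ← sq, add_comm]
        exact pow_le_pow_left₀ (by linarith) (Real.add_one_le_exp _) 2
      have : 0 ≤ κ := by linarith
      gcongr
    · calc M * lambda f (newtonStep f p.1 p.2) ≤ M * (linearRate κ * lambda f p.1) := by gcongr
        _ = linearRate κ * (M * lambda f p.1) := by ring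
        _ ≤ linearRate κ * lambdaBound κ k :=
          mul_le_mul_of_nonneg_left ih.mul_lambda_le (linearRate_pos hκ).le
        _ = _ := (lambdaBound_succ κ k).symm
    · rw [pow_succ', mul_assoc]
      exact hcon.trans (mul_le_mul_of_nonneg_left ih.lambda_le (linearRate_pos hκ).le)

lemma IteratesBounds.le_three_halves_smul {κ : ℝ} {x₀ : EuclideanSpace ℝ (Fin d)} {k : ℕ}
    {p : EuclideanSpace ℝ (Fin d) × Matrix (Fin d) (Fin d) ℝ} (h : IteratesBounds f M κ x₀ k p)
    (hs : StronglyConvexSmooth μ L f) (hκ : 1 ≤ κ) : p.2 ≤ (3 / 2 * κ) • hessian f p.1 := by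
  refine h.le_smul.trans (smul_le_smul_of_nonneg_right ?_ (nonneg_of_posDef (hs.posDef _)))
  rw [mul_comm]
  exact mul_le_mul_of_nonneg_right (exp_sum_lambdaBound_le hκ k) (by linarith)

end Invariants

/-! ### Measurability of the iterates -/

section Measurability

variable {α : Type*} [MeasurableSpace α] {d : ℕ}

lemma measurable_apply_mulVec {A : α → Matrix (Fin d) (Fin d) ℝ} {v : α → Fin d → ℝ}
    (hA : ∀ i j, Measurable fun a => A a i j) (hv : ∀ i, Measurable fun a => v a i) (i : Fin d) :
    Measurable fun a => (A a *ᵥ v a) i := by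
  simp only [mulVec, dotProduct]
  exact Finset.measurable_sum _ fun j _ => (hA i j).mul (hv j)

lemma measurable_dotProduct {v w : α → Fin d → ℝ} (hv : ∀ i, Measurable fun a => v a i)
    (hw : ∀ i, Measurable fun a => w a i) : Measurable fun a => v a ⬝ᵥ w a := by
  simp only [dotProduct]
  exact Finset.measurable_sum _ fun j _ => (hv j).mul (hw j)

lemma measurable_apply_mul {A B : α → Matrix (Fin d) (Fin d) ℝ}
    (hA : ∀ i j, Measurable fun a => A a i j) (hB : ∀ i j, Measurable fun a => B a i j)
    (i j : Fin d) : Measurable fun a => (A a * B a) i j := by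
  simp only [mul_apply]
  exact Finset.measurable_sum _ fun k _ => (hA i k).mul (hB k j)

lemma measurable_trace {A : α → Matrix (Fin d) (Fin d) ℝ}
    (hA : ∀ i j, Measurable fun a => A a i j) : Measurable fun a => (A a).trace := by
  simp only [trace, diag_apply]
  exact Finset.measurable_sum _ fun k _ => hA k k

lemma measurable_det {A : α → Matrix (Fin d) (Fin d) ℝ}
    (hA : ∀ i j, Measurable fun a => A a i j) : Measurable fun a => (A a).det := by
  simp only [det_apply']
  exact Finset.measurable_sum _ fun σ _ =>
    (Finset.measurable_prod _ fun i _ => hA (σ i) i).const_mul _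

lemma measurable_apply_inv {A : α → Matrix (Fin d) (Fin d) ℝ}
    (hA : ∀ i j, Measurable fun a => A a i j) (i j : Fin d) :
    Measurable fun a => (A a)⁻¹ i j := by
  simp only [inv_def, Matrix.smul_apply, smul_eq_mul, Ring.inverse_eq_inv', adjugate_apply]
  refine (measurable_det hA).inv.mul (measurable_det fun k l => ?_)
  simp only [updateRow_apply]
  split_ifs
  · exact measurable_const
  · exact hA k l

lemma measurable_apply_gradient {f : EuclideanSpace ℝ (Fin d) → ℝ} (hf : TwiceDifferentiable f)
    {x : α → EuclideanSpace ℝ (Fin d)} (hx : Measurable x) (i : Fin d) :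
    Measurable fun a => (gradient f (x a)).ofLp i := by
  have h : Measurable (gradient f) := hf.2.continuous.measurable
  exact (EuclideanSpace.proj (𝕜 := ℝ) i).continuous.measurable.comp (h.comp hx)

lemma measurable_apply_hessian (f : EuclideanSpace ℝ (Fin d) → ℝ)
    {x : α → EuclideanSpace ℝ (Fin d)} (hx : Measurable x) (i j : Fin d) :
    Measurable fun a => hessian f (x a) i j :=
  (EuclideanSpace.proj (𝕜 := ℝ) i).continuous.measurable.comp
    ((measurable_fderiv_apply_const ℝ (gradient f) _).comp hx)

lemma measurable_apply_ofLp {x : α → EuclideanSpace ℝ (Fin d)} (hx : Measurable x) (i : Fin d) :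
    Measurable fun a => (x a).ofLp i :=
  (EuclideanSpace.proj (𝕜 := ℝ) i).continuous.measurable.comp hx

lemma measurable_newtonStep {f : EuclideanSpace ℝ (Fin d) → ℝ} (hf : TwiceDifferentiable f)
    {x : α → EuclideanSpace ℝ (Fin d)} {G : α → Matrix (Fin d) (Fin d) ℝ} (hx : Measurable x)
    (hG : ∀ i j, Measurable fun a => G a i j) : Measurable fun a => newtonStep f (x a) (G a) := by
  refine hx.sub ((WithLp.measurable_toLp 2 _).comp
    (measurable_pi_lambda _ fun i => ?_))
  exact measurable_apply_mulVec (measurable_apply_inv hG) (measurable_apply_gradient hf hx) i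

lemma measurable_matNorm {A : α → Matrix (Fin d) (Fin d) ℝ} {v : α → Fin d → ℝ}
    (hA : ∀ i j, Measurable fun a => A a i j) (hv : ∀ i, Measurable fun a => v a i) :
    Measurable fun a => matNorm (A a) (v a) :=
  (measurable_dotProduct hv (measurable_apply_mulVec hA hv)).sqrt

lemma measurable_apply_corrected {f : EuclideanSpace ℝ (Fin d) → ℝ} (hf : TwiceDifferentiable f)
    (M : ℝ) {p : α → EuclideanSpace ℝ (Fin d) × Matrix (Fin d) (Fin d) ℝ}
    (hx : Measurable fun a => (p a).1) (hG : ∀ i j, Measurable fun a => (p a).2 i j) (i j : Fin d) :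
    Measurable fun a => corrected f M (p a) i j := by
  have h := measurable_matNorm (measurable_apply_hessian f hx)
    (measurable_apply_ofLp ((measurable_newtonStep hf hx hG).sub hx))
  exact ((h.const_mul M).const_add 1).mul (hG i j)

lemma measurable_apply_residual {f : EuclideanSpace ℝ (Fin d) → ℝ} (hf : TwiceDifferentiable f)
    (M : ℝ) {p : α → EuclideanSpace ℝ (Fin d) × Matrix (Fin d) (Fin d) ℝ}
    (hx : Measurable fun a => (p a).1) (hG : ∀ i j, Measurable fun a => (p a).2 i j) (i j : Fin d) :
    Measurable fun a => residual f M (p a) i j :=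
  (measurable_apply_corrected hf M hx hG i j).sub
    (measurable_apply_hessian f (measurable_newtonStep hf hx hG) i j)

lemma measurable_potential (f : EuclideanSpace ℝ (Fin d) → ℝ)
    {p : α → EuclideanSpace ℝ (Fin d) × Matrix (Fin d) (Fin d) ℝ}
    (hx : Measurable fun a => (p a).1) (hG : ∀ i j, Measurable fun a => (p a).2 i j) :
    Measurable fun a => potential f (p a) :=
  (measurable_trace (measurable_apply_mul (measurable_apply_inv (measurable_apply_hessian f hx))
    hG)).sub_const _

lemma measurable_apply_broyd {τ : α → ℝ} {G A : α → Matrix (Fin d) (Fin d) ℝ} {u : α → Fin d → ℝ}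
    (hτ : Measurable τ) (hG : ∀ i j, Measurable fun a => G a i j)
    (hA : ∀ i j, Measurable fun a => A a i j) (hu : ∀ i, Measurable fun a => u a i) (i j : Fin d) :
    Measurable fun a => broyd (τ a) (G a) (A a) (u a) i j := by
  have hR : ∀ i j, Measurable fun a => (G a - A a) i j := fun i j => (hG i j).sub (hA i j)
  have hU : ∀ i j, Measurable fun a => vecMulVec (u a) (u a) i j := fun i j => (hu i).mul (hu j)
  have hs : MeasurableSet {a | G a *ᵥ u a = A a *ᵥ u a} :=
    measurableSet_eq_fun (measurable_pi_lambda _ (measurable_apply_mulVec hG hu))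
      (measurable_pi_lambda _ (measurable_apply_mulVec hA hu))
  have hGq := measurable_dotProduct hu (measurable_apply_mulVec hG hu)
  have hAq := measurable_dotProduct hu (measurable_apply_mulVec hA hu)
  have hRq := measurable_dotProduct hu (measurable_apply_mulVec hR hu)
  have e : (fun a => broyd (τ a) (G a) (A a) (u a) i j) = fun a =>
      haveI := Classical.dec (G a *ᵥ u a = A a *ᵥ u a)
      if G a *ᵥ u a = A a *ᵥ u a then G a i j else
        τ a * (G a i j - (u a ⬝ᵥ A a *ᵥ u a)⁻¹ * ((A a * vecMulVec (u a) (u a) * G a) i j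
            + (G a * vecMulVec (u a) (u a) * A a) i j)
          + (((u a ⬝ᵥ G a *ᵥ u a) / (u a ⬝ᵥ A a *ᵥ u a) + 1) / (u a ⬝ᵥ A a *ᵥ u a))
            * (A a * vecMulVec (u a) (u a) * A a) i j)
        + (1 - τ a) * (G a i j - (u a ⬝ᵥ (G a - A a) *ᵥ u a)⁻¹
            * ((G a - A a) * vecMulVec (u a) (u a) * (G a - A a)) i j) := by
    funext a
    by_cases h : G a *ᵥ u a = A a *ᵥ u a
    · simp only [broyd, if_pos h]
    · simp only [broyd, if_neg h, Matrix.add_apply, Matrix.sub_apply, Matrix.smul_apply,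
        smul_eq_mul]
  rw [e]
  refine Measurable.ite hs (hG i j) ?_
  refine (hτ.mul (((hG i j).sub (hAq.inv.mul ?_)).add ((((hGq.div hAq).add_const 1).div hAq).mul
    ?_))).add ((measurable_const.sub hτ).mul ((hG i j).sub (hRq.inv.mul ?_)))
  · exact (measurable_apply_mul (measurable_apply_mul hA hU) hG i j).add
      (measurable_apply_mul (measurable_apply_mul hG hU) hA i j)
  · exact measurable_apply_mul (measurable_apply_mul hA hU) hA i j
  · exact measurable_apply_mul (measurable_apply_mul hR hU) hR i j

end Measurability

section Adapted

variable {d : ℕ} {f : EuclideanSpace ℝ (Fin d) → ℝ} {Ω : Type*} [mΩ : MeasurableSpace Ω]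
  {P : Measure Ω} {ℱ : Filtration ℕ mΩ} {D : Measure (EuclideanSpace ℝ (Fin d))}
  {u : ℕ → Ω → EuclideanSpace ℝ (Fin d)} {τ : ℕ → Ω → ℝ}

/-- The iterates are adapted to the filtration: `(x_k, G_k)` is determined by the information
available before step `k`. -/
lemma RandomChoices.measurable_iterates (hR : RandomChoices P ℱ D u τ)
    (hf : TwiceDifferentiable f) (M L : ℝ) (x₀ : EuclideanSpace ℝ (Fin d)) (k : ℕ) :
    Measurable[ℱ k] (fun ω => (iterates f M L x₀ (fun j => u j ω) (fun j => τ j ω) k).1) ∧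
    ∀ i j, Measurable[ℱ k]
      (fun ω => (iterates f M L x₀ (fun j => u j ω) (fun j => τ j ω) k).2 i j) := by
  induction k with
  | zero => exact ⟨measurable_const, fun i j => measurable_const⟩
  | succ k ih =>
    have hle : ℱ k ≤ ℱ (k + 1) := ℱ.mono (Nat.le_succ k)
    have hx := ih.1.mono hle le_rfl
    have hG := fun i j => (ih.2 i j).mono hle le_rfl
    have hy := @measurable_newtonStep Ω (ℱ (k + 1)) d f hf _ _ hx hG
    refine ⟨hy, fun i j => ?_⟩
    exact @measurable_apply_broyd Ω (ℱ (k + 1)) d _ _ _ _ (hR.tau_measurable k)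
      (@measurable_apply_corrected Ω (ℱ (k + 1)) d f hf M _ hx hG)
      (@measurable_apply_hessian Ω (ℱ (k + 1)) d f _ hy)
      (@measurable_apply_ofLp Ω (ℱ (k + 1)) d _ (hR.u_measurable k)) i j

end Adapted

/-! ### The expected decrease of the potential -/

section Expectation

open scoped MatrixOrder

variable {d : ℕ}

lemma abs_mul_div_dotProduct_le_one (v : Fin d → ℝ) (i j : Fin d) :
    |v i * v j / (v ⬝ᵥ v)| ≤ 1 := by
  have h : ∀ i, v i * v i ≤ v ⬝ᵥ v := fun i =>
    Finset.single_le_sum (f := fun i => v i * v i) (fun i _ => mul_self_nonneg (v i))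
      (Finset.mem_univ i)
  have h0 : 0 ≤ v ⬝ᵥ v := (mul_self_nonneg _).trans (h i)
  rw [abs_div, abs_of_nonneg h0]
  refine div_le_one_of_le₀ (abs_le.2 ⟨?_, ?_⟩) h0
  · nlinarith [h i, h j, sq_nonneg (v i + v j)]
  · nlinarith [h i, h j, sq_nonneg (v i - v j)]

lemma quad_div_dotProduct_eq_sum (R : Matrix (Fin d) (Fin d) ℝ) (v : Fin d → ℝ) :
    (v ⬝ᵥ R *ᵥ v) / (v ⬝ᵥ v) = ∑ i, ∑ j, R i j * (v i * v j / (v ⬝ᵥ v)) := by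
  conv_lhs => rw [dotProduct, Finset.sum_div]
  refine Finset.sum_congr rfl fun i _ => ?_
  rw [mulVec, dotProduct, Finset.mul_sum, Finset.sum_div]
  exact Finset.sum_congr rfl fun j _ => by ring

variable {f : EuclideanSpace ℝ (Fin d) → ℝ} {μ L M : ℝ} {Ω : Type*} [mΩ : MeasurableSpace Ω]
  {P : Measure Ω} [IsProbabilityMeasure P] {ℱ : Filtration ℕ mΩ}
  {D : Measure (EuclideanSpace ℝ (Fin d))}
  {u : ℕ → Ω → EuclideanSpace ℝ (Fin d)} {τ : ℕ → Ω → ℝ}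

/-- A bounded random matrix `R` known before step `k` satisfies
`𝔼[u_kᵀ R u_k / (u_kᵀ u_k)] = 𝔼[tr R] / d`, by independence of `u_k` and isotropy of its law. -/
lemma RandomChoices.integral_quad_div (hR : RandomChoices P ℱ D u τ)
    (hD : IsotropicDirection D) {k : ℕ} {R : Ω → Matrix (Fin d) (Fin d) ℝ} {C : ℝ}
    (hm : ∀ i j, Measurable[ℱ k] fun ω => R ω i j) (hC : ∀ ω i j, |R ω i j| ≤ C) :
    Integrable (fun ω => ((u k ω).ofLp ⬝ᵥ R ω *ᵥ (u k ω).ofLp)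
        / ((u k ω).ofLp ⬝ᵥ (u k ω).ofLp)) P ∧
      ∫ ω, ((u k ω).ofLp ⬝ᵥ R ω *ᵥ (u k ω).ofLp) / ((u k ω).ofLp ⬝ᵥ (u k ω).ofLp) ∂P
        = 1 / d * ∫ ω, (R ω).trace ∂P := by
  simp only [quad_div_dotProduct_eq_sum]
  have hu : Measurable (u k) := (hR.u_measurable k).mono (ℱ.le _) le_rfl
  have hm' : ∀ i j, Measurable fun ω => R ω i j := fun i j => (hm i j).mono (ℱ.le _) le_rfl
  have hw : ∀ i j, Measurable fun v : EuclideanSpace ℝ (Fin d) => v i * v j / (v.ofLp ⬝ᵥ v.ofLp) :=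
    fun i j =>
      ((measurable_apply_ofLp measurable_id i).mul (measurable_apply_ofLp measurable_id j)).div
        (measurable_dotProduct (measurable_apply_ofLp measurable_id)
          (measurable_apply_ofLp measurable_id))
  have hRint : ∀ i j, Integrable (fun ω => R ω i j) P := fun i j =>
    Integrable.of_bound (hm' i j).aestronglyMeasurable C (ae_of_all _ fun ω => hC ω i j)
  have hint : ∀ i j, Integrable (fun ω => R ω i j *
      ((u k ω).ofLp i * (u k ω).ofLp j / ((u k ω).ofLp ⬝ᵥ (u k ω).ofLp))) P := fun i j =>
    (hRint i j).mul_bdd (c := 1) ((hw i j).comp hu).aestronglyMeasurable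
      (ae_of_all _ fun ω => abs_mul_div_dotProduct_le_one _ i j)
  have hval : ∀ i j, ∫ ω, R ω i j *
      ((u k ω).ofLp i * (u k ω).ofLp j / ((u k ω).ofLp ⬝ᵥ (u k ω).ofLp)) ∂P
      = (∫ ω, R ω i j ∂P) * ((1 / (d : ℝ)) • (1 : Matrix (Fin d) (Fin d) ℝ)) i j := by
    intro i j
    have hind : IndepFun (fun ω => R ω i j) (fun ω =>
        (u k ω).ofLp i * (u k ω).ofLp j / ((u k ω).ofLp ⬝ᵥ (u k ω).ofLp)) P := by
      rw [IndepFun_iff_Indep]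
      refine indep_of_indep_of_le_left (indep_of_indep_of_le_right (hR.u_indep k).symm ?_)
        (hm i j).comap_le
      rintro _ ⟨s, hs, rfl⟩
      exact ⟨_, hw i j hs, rfl⟩
    rw [hind.integral_fun_mul_eq_mul_integral (hm' i j).aestronglyMeasurable
      ((hw i j).comp hu).aestronglyMeasurable, ← hD i j, ← hR.u_law k,
      integral_map hu.aemeasurable (hw i j).aestronglyMeasurable]
  refine ⟨integrable_finsetSum _ fun i _ => integrable_finsetSum _ fun j _ => hint i j, ?_⟩
  rw [integral_finsetSum _ fun i _ => integrable_finsetSum _ fun j _ => hint i j]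
  simp only [trace, diag_apply]
  rw [integral_finsetSum _ fun i _ => hRint i i, Finset.mul_sum]
  refine Finset.sum_congr rfl fun i _ => ?_
  rw [integral_finsetSum _ fun j _ => hint i j, Finset.sum_congr rfl fun j _ => hval i j,
    Finset.sum_eq_single i]
  · rw [Matrix.smul_apply, one_apply_eq, smul_eq_mul, mul_one, mul_comm]
  · intro j _ hj
    rw [Matrix.smul_apply, one_apply_ne hj.symm, smul_zero, mul_zero]
  · simp

variable [NeZero d]

lemma RandomChoices.integrable_potential (hR : RandomChoices P ℱ D u τ)
    (hs : StronglyConvexSmooth μ L f) (hc : StronglySelfConcordant M f)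
    {x₀ : EuclideanSpace ℝ (Fin d)}
    (h0 : M * lambda f x₀ ≤ Real.log (3 / 2) / (4 * (L / μ))) (k : ℕ) :
    Integrable (fun ω => potential f
      (iterates f M L x₀ (fun j => u j ω) (fun j => τ j ω) k)) P := by
  have hκ := one_le_of_stronglyConvexSmooth hs
  obtain ⟨hx, hG⟩ := hR.measurable_iterates hs.twiceDifferentiable M L x₀ k
  have hmeas := measurable_potential f (hx.mono (ℱ.le _) le_rfl)
    fun i j => (hG i j).mono (ℱ.le _) le_rfl
  refine Integrable.of_bound hmeas.aestronglyMeasurable (d * (3 / 2 * (L / μ) - 1))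
    (ae_of_all _ fun ω => ?_)
  have hb := iteratesBounds hs hc h0 (fun j => u j ω) (fun k => hR.tau_mem k ω) k
  rw [Real.norm_of_nonneg (potential_nonneg hs hb.hessian_le)]
  exact potential_le hs (hb.le_three_halves_smul hs hκ)

/-- One step of the recursion for the expected potential. -/
lemma RandomChoices.integral_potential_succ_le (hR : RandomChoices P ℱ D u τ)
    (hD : IsotropicDirection D) (hs : StronglyConvexSmooth μ L f)
    (hc : StronglySelfConcordant M f) {x₀ : EuclideanSpace ℝ (Fin d)}
    (h0 : M * lambda f x₀ ≤ Real.log (3 / 2) / (4 * (L / μ))) (k : ℕ) :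
    ∫ ω, potential f (iterates f M L x₀ (fun j => u j ω) (fun j => τ j ω) (k + 1)) ∂P
      ≤ (1 - 1 / (d * (L / μ))) * ((1 + lambdaBound (L / μ) k) ^ 2 *
        (∫ ω, potential f (iterates f M L x₀ (fun j => u j ω) (fun j => τ j ω) k) ∂P
          + 2 * d * lambdaBound (L / μ) k)) := by
  have hκ := one_le_of_stronglyConvexSmooth hs
  have hμ := hs.mu_pos
  have hL := hs.L_pos
  have hd : (1 : ℝ) ≤ d := by exact_mod_cast NeZero.one_le
  set κ := L / μ with hκdef
  set m := lambdaBound κ k with hm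
  have hm0 : 0 ≤ m := lambdaBound_nonneg hκ k
  let Y : Ω → EuclideanSpace ℝ (Fin d) × Matrix (Fin d) (Fin d) ℝ :=
    fun ω => iterates f M L x₀ (fun j => u j ω) (fun j => τ j ω) k
  have hb : ∀ ω, IteratesBounds f M κ x₀ k (Y ω) := fun ω =>
    iteratesBounds hs hc h0 (fun j => u j ω) (fun k => hR.tau_mem k ω) k
  let S : Ω → ℝ := fun ω =>
    ((hessian f (newtonStep f (Y ω).1 (Y ω).2))⁻¹ * residual f M (Y ω)).trace
  obtain ⟨hx, hG⟩ := hR.measurable_iterates hs.twiceDifferentiable M L x₀ k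
  have hRm : ∀ i j, Measurable[ℱ k] fun ω => residual f M (Y ω) i j :=
    @measurable_apply_residual Ω (ℱ k) d f hs.twiceDifferentiable M Y hx hG
  have hRm' : ∀ i j, Measurable fun ω => residual f M (Y ω) i j := fun i j =>
    (hRm i j).mono (ℱ.le _) le_rfl
  have hSm : Measurable S := measurable_trace (measurable_apply_mul (measurable_apply_inv
    (measurable_apply_hessian f (measurable_newtonStep hs.twiceDifferentiable
      (hx.mono (ℱ.le _) le_rfl) fun i j => (hG i j).mono (ℱ.le _) le_rfl))) hRm')
  have hSle : ∀ ω, S ω ≤ (1 + m) ^ 2 * (potential f (Y ω) + 2 * d * m) := fun ω =>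
    trace_inv_hessian_mul_residual_le hs hc (hb ω).hessian_le (hb ω).mul_lambda_le
  have hS0 : ∀ ω, 0 ≤ S ω := fun ω =>
    trace_mul_nonneg (nonneg_of_posDef (hs.posDef _).inv) (residual_nonneg hc (hb ω).hessian_le)
  have hpint := hR.integrable_potential hs hc h0 k
  have hbint : Integrable (fun ω => (1 + m) ^ 2 * (potential f (Y ω) + 2 * d * m)) P :=
    (hpint.add (integrable_const _)).const_mul _
  have hSint : Integrable S P := hbint.mono' hSm.aestronglyMeasurable
    (ae_of_all _ fun ω => by rw [Real.norm_of_nonneg (hS0 ω)]; exact hSle ω)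
  obtain ⟨C, hC⟩ : ∃ C : ℝ, ∀ ω i j, |residual f M (Y ω) i j| ≤ C := by
    refine ⟨(1 + m) ^ 2 * (3 / 2 * κ) * L, fun ω => abs_apply_le_of_le_smul_one
      (residual_nonneg hc (hb ω).hessian_le) ?_⟩
    have h1 := corrected_le_smul hs hc (hb ω).hessian_le (by linarith)
      ((hb ω).le_three_halves_smul hs hκ)
      (hb ω).mul_lambda_le
    have h2 : residual f M (Y ω) ≤ corrected f M (Y ω) :=
      sub_le_self _ (nonneg_of_posDef (hs.posDef _))
    refine (h2.trans h1).trans ?_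
    rw [mul_smul _ L]
    exact smul_le_smul_of_nonneg_left (hs.le_smul_one _) (by positivity)
  obtain ⟨hqint, hq⟩ := hR.integral_quad_div hD hRm hC
  have htint : Integrable (fun ω => (residual f M (Y ω)).trace) P := by
    simp only [trace, diag_apply]
    exact integrable_finsetSum _ fun i _ => Integrable.of_bound (hRm' i i).aestronglyMeasurable C
      (ae_of_all _ fun ω => hC ω i i)
  have htr : μ * ∫ ω, S ω ∂P ≤ ∫ ω, (residual f M (Y ω)).trace ∂P := by
    rw [← integral_const_mul]
    exact integral_mono (hSint.const_mul _) htint fun ω =>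
      mul_trace_inv_hessian_mul_residual_le hs hc (hb ω).hessian_le
  have hstep : ∫ ω, potential f (iterates f M L x₀ (fun j => u j ω) (fun j => τ j ω) (k + 1)) ∂P
      ≤ ∫ ω, S ω ∂P - (1 / d * ∫ ω, (residual f M (Y ω)).trace ∂P) / L := by
    rw [← hq, ← integral_div, ← integral_sub hSint (hqint.div_const L)]
    exact integral_mono (hR.integrable_potential hs hc h0 (k + 1)) (hSint.sub (hqint.div_const L))
      fun ω => potential_broyd_le hs hc (hb ω).hessian_le (hR.tau_mem k ω) (u k ω).ofLp
  have hSI : ∫ ω, S ω ∂P ≤ (1 + m) ^ 2 * (∫ ω, potential f (Y ω) ∂P + 2 * d * m) := by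
    refine (integral_mono hSint hbint hSle).trans_eq ?_
    rw [integral_const_mul, integral_add hpint (integrable_const _), integral_const, probReal_univ,
      one_smul]
  have hρ : 0 ≤ 1 - 1 / (d * κ) := by
    rw [sub_nonneg, div_le_one (by positivity)]
    exact one_le_mul_of_one_le_of_one_le hd hκ
  refine hstep.trans (le_trans ?_ (mul_le_mul_of_nonneg_left hSI hρ))
  have h5 : (1 / d * (μ * ∫ ω, S ω ∂P)) / L ≤ (1 / d * ∫ ω, (residual f M (Y ω)).trace ∂P) / L := by
    gcongr
  have h6 : (1 / d * (μ * ∫ ω, S ω ∂P)) / L = 1 / (d * κ) * ∫ ω, S ω ∂P := by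
    rw [hκdef]; field_simp
  linarith

/-- The expected potential decays like `(1 - 1/(dκ))ᵏ` from the start. The recursion closes for the
sum of the expected potential and `48 d κ` times the deterministic bound for `M λ_f(x_k)`, because
the latter decays at a rate that is strictly better than `1 - 1/(dκ)` when `d ≥ 2`. -/
lemma RandomChoices.integral_potential_le (hR : RandomChoices P ℱ D u τ)
    (hD : IsotropicDirection D) (hd : 2 ≤ d) (hs : StronglyConvexSmooth μ L f)
    (hc : StronglySelfConcordant M f) {x₀ : EuclideanSpace ℝ (Fin d)}
    (h0 : M * lambda f x₀ ≤ Real.log (3 / 2) / (4 * (L / μ))) (k : ℕ) :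
    ∫ ω, potential f (iterates f M L x₀ (fun j => u j ω) (fun j => τ j ω) k) ∂P
      ≤ 9 * (d * (L / μ)) * (1 - 1 / (d * (L / μ))) ^ k := by
  have hκ := one_le_of_stronglyConvexSmooth hs
  set κ := L / μ
  have hd' : (2 : ℝ) ≤ d := by exact_mod_cast hd
  have hκ0 : 0 < κ := by linarith
  set ρ := 1 - 1 / (d * κ) with hρ
  have hρ1 : 1 - 1 / (2 * κ) ≤ ρ := by
    rw [hρ]
    have : 1 / (d * κ) ≤ 1 / (2 * κ) := one_div_le_one_div_of_le (by positivity) (by gcongr)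
    linarith
  have hκh : 1 / (2 * κ) ≤ 1 / 2 := one_div_le_one_div_of_le (by norm_num) (by linarith)
  have hρ0 : 0 ≤ ρ := by linarith
  set s : ℕ → ℝ := fun k =>
    ∫ ω, potential f (iterates f M L x₀ (fun j => u j ω) (fun j => τ j ω) k) ∂P with hsdef
  have hsnn : ∀ k, 0 ≤ s k := fun k => integral_nonneg fun ω => potential_nonneg hs
    (iteratesBounds hs hc h0 (fun j => u j ω) (fun k => hR.tau_mem k ω) k).hessian_le
  have hind : ∀ k, s k + 48 * d * κ * lambdaBound κ k
      ≤ ρ ^ k * (Real.exp (2 * ∑ i ∈ Finset.range k, lambdaBound κ i)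
        * (s 0 + 48 * d * κ * lambdaBound κ 0)) := by
    intro k
    induction k with
    | zero => simp
    | succ k ih =>
      have hstep : s (k + 1) ≤ ρ * ((1 + lambdaBound κ k) ^ 2 * (s k + 2 * d * lambdaBound κ k)) :=
        hR.integral_potential_succ_le hD hs hc h0 k
      have hm := lambdaBound_nonneg hκ k
      have hsk := hsnn k
      rw [lambdaBound_succ]
      set m := lambdaBound κ k
      have hrate : 48 * d * κ * linearRate κ ≤ ρ * (48 * d * κ - 2 * d) := by
        have h1 : 48 * d * κ * linearRate κ = 48 * d * κ - 26 * d := by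
          rw [linearRate]; field_simp; ring
        have h2 : (1 - 1 / (2 * κ)) * (48 * d * κ - 2 * d) = 48 * d * κ - 26 * d + d / κ := by
          field_simp; ring
        have h3 : (1 - 1 / (2 * κ)) * (48 * d * κ - 2 * d) ≤ ρ * (48 * d * κ - 2 * d) :=
          mul_le_mul_of_nonneg_right hρ1 (by nlinarith)
        have h4 : 0 ≤ d / κ := by positivity
        linarith
      have h1m : 1 ≤ (1 + m) ^ 2 := one_le_pow₀ (by linarith)
      have hrate0 : 0 ≤ ρ * (48 * d * κ - 2 * d) := mul_nonneg hρ0 (by nlinarith)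
      have h5 : 48 * d * κ * (linearRate κ * m) ≤ (1 + m) ^ 2 * (ρ * (48 * d * κ - 2 * d)) * m := by
        rw [← mul_assoc]
        exact mul_le_mul_of_nonneg_right (hrate.trans (le_mul_of_one_le_left hrate0 h1m)) hm
      have h6 : (1 + m) ^ 2 ≤ Real.exp (2 * m) := by
        rw [two_mul, Real.exp_add, ← sq, add_comm]
        exact pow_le_pow_left₀ (by linarith) (Real.add_one_le_exp _) 2
      calc s (k + 1) + 48 * d * κ * (linearRate κ * m)
          ≤ ρ * (1 + m) ^ 2 * (s k + 48 * d * κ * m) := by linarith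
        _ ≤ ρ * Real.exp (2 * m) * (ρ ^ k * (Real.exp (2 * ∑ i ∈ Finset.range k, lambdaBound κ i)
              * (s 0 + 48 * d * κ * lambdaBound κ 0))) := by gcongr
        _ = _ := by rw [Finset.sum_range_succ, mul_add 2, Real.exp_add]; ring
  have hstart : s 0 + 48 * d * κ * lambdaBound κ 0 ≤ 6 * (d * κ) := by
    have h1 : s 0 ≤ d * (κ - 1) := by
      have h : ∀ ω, potential f (iterates f M L x₀ (fun j => u j ω) (fun j => τ j ω) 0)
          ≤ d * (κ - 1) := fun ω => potential_le hs (by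
        simpa using (iteratesBounds hs hc h0 (fun j => u j ω) (fun k => hR.tau_mem k ω) 0).le_smul)
      refine (integral_mono (hR.integrable_potential hs hc h0 0) (integrable_const _) h).trans_eq ?_
      simp
    have h2 : 48 * d * κ * lambdaBound κ 0 ≤ 48 * d * κ * (1 / (8 * κ)) := by
      gcongr; exact lambdaBound_le_const hκ 0
    have h3 : 48 * d * κ * (1 / (8 * κ)) = 6 * d := by field_simp; norm_num
    nlinarith
  have hm := lambdaBound_nonneg hκ k
  calc s k ≤ s k + 48 * d * κ * lambdaBound κ k := le_add_of_nonneg_right (by positivity)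
    _ ≤ _ := hind k
    _ ≤ ρ ^ k * (3 / 2 * (6 * (d * κ))) := by
      have := hsnn 0
      have := lambdaBound_nonneg hκ 0
      exact mul_le_mul_of_nonneg_left (mul_le_mul (exp_sum_lambdaBound_le hκ k) hstart
        (by positivity) (by norm_num)) (pow_nonneg hρ0 k)
    _ = _ := by ring

end Expectation

/-! ### Superlinear convergence with high probability -/

section HighProbability

/-- On a run where the potential is at most `(2/5) ρ^j` at step `k₀ + j`, for all `j`, the method
converges superlinearly after step `k₀`. -/
lemma lambda_iterates_le_of_potential_le {d : ℕ} [NeZero d] (hd : 2 ≤ d)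
    {f : EuclideanSpace ℝ (Fin d) → ℝ} {μ L M : ℝ} (hs : StronglyConvexSmooth μ L f)
    (hc : StronglySelfConcordant M f) {x₀ : EuclideanSpace ℝ (Fin d)}
    (h0 : M * lambda f x₀ ≤ Real.log (3 / 2) / (4 * (L / μ)))
    {u : ℕ → EuclideanSpace ℝ (Fin d)} {τ : ℕ → ℝ} (hτ : ∀ k, τ k ∈ Set.Icc (0 : ℝ) 1) (k₀ : ℕ)
    (h : ∀ j, potential f (iterates f M L x₀ u τ (k₀ + j))
      ≤ 2 / 5 * (1 - 1 / (d * (L / μ) + 1)) ^ j) (k : ℕ) :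
    lambda f (iterates f M L x₀ u τ (k₀ + k)).1
      ≤ (1 - 1 / (d * (L / μ) + 1)) ^ (k * (k - 1) / 2) * (1 / 2) ^ k
        * (1 - 1 / (2 * (L / μ))) ^ k₀ * lambda f x₀ := by
  have hκ := one_le_of_stronglyConvexSmooth hs
  set κ := L / μ
  have hκ0 : 0 < κ := by linarith
  have hd' : (2 : ℝ) ≤ d := by exact_mod_cast hd
  have hb := fun k => iteratesBounds hs hc h0 u hτ k
  have hq0 := linearRate_pos hκ
  have hq1 := linearRate_le_one hκ
  have hl0 := lambda_nonneg f x₀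
  set ρ := 1 - 1 / (d * κ + 1) with hρ
  have hqρ : linearRate κ ≤ ρ := by
    rw [linearRate, hρ]
    have : 1 / (d * κ + 1) ≤ 13 / (24 * κ) := by
      rw [div_le_div_iff₀ (by positivity) (by positivity)]
      nlinarith
    linarith
  have hρ0 : 0 ≤ ρ := hq0.le.trans hqρ
  induction k with
  | zero =>
    have hq2 : linearRate κ ≤ 1 - 1 / (2 * κ) := by
      rw [linearRate]
      have : 1 / (2 * κ) ≤ 13 / (24 * κ) := by
        rw [div_le_div_iff₀ (by positivity) (by positivity)]
        nlinarith
      linarith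
    simp only [add_zero, zero_mul, Nat.zero_div, pow_zero, one_mul]
    exact (hb k₀).lambda_le.trans (by gcongr)
  | succ k ih =>
    rw [← add_assoc, iterates_succ, Nat.triangle_succ, pow_add, pow_succ]
    have hmb : lambdaBound κ (k₀ + k) ≤ 1 / 8 * ρ ^ k := by
      refine (lambdaBound_le hκ _).trans ?_
      have h8 : 1 / (8 * κ) ≤ 1 / 8 := one_div_le_one_div_of_le (by norm_num) (by linarith)
      refine mul_le_mul h8 ?_ (by positivity) (by norm_num)
      rw [pow_add]
      exact (mul_le_of_le_one_left (by positivity) (pow_le_one₀ hq0.le hq1)).trans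
        (pow_le_pow_left₀ hq0.le hqρ k)
    have hm0 := lambdaBound_nonneg hκ (k₀ + k)
    have hm8 : lambdaBound κ (k₀ + k) ≤ 1 / 8 :=
      (lambdaBound_le_const hκ _).trans (one_div_le_one_div_of_le (by norm_num) (by linarith))
    have hσ := potential_nonneg hs (hb (k₀ + k)).hessian_le
    have hstep := lambda_newtonStep_le_potential hs hc (hb (k₀ + k)).hessian_le
      (hb (k₀ + k)).mul_lambda_le
    have hfac : (1 + lambdaBound κ (k₀ + k) / 2)
        * (potential f (iterates f M L x₀ u τ (k₀ + k)) + lambdaBound κ (k₀ + k) / 2)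
          ≤ 1 / 2 * ρ ^ k := by
      calc _ ≤ (1 + 1 / 16) * (2 / 5 * ρ ^ k + 1 / 16 * ρ ^ k) := by
            have := h k
            apply mul_le_mul <;> linarith
        _ ≤ 1 / 2 * ρ ^ k := by nlinarith [pow_nonneg hρ0 k]
    refine hstep.trans ((mul_le_mul hfac ih (lambda_nonneg _ _) (by positivity)).trans_eq ?_)
    ring

/-- Markov's inequality and a union bound: if the expectations of nonnegative `σ_j` are so small
that `∑ 𝔼[σ_j] / t_j ≤ δ`, then `σ_j ≤ t_j` for all `j` with probability at least `1 - δ`. -/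
lemma one_sub_le_measureReal_forall_le {Ω : Type*} [MeasurableSpace Ω] {P : Measure Ω}
    [IsProbabilityMeasure P] {σ : ℕ → Ω → ℝ} {t b : ℕ → ℝ} {δ : ℝ} (hint : ∀ j, Integrable (σ j) P)
    (hσ : ∀ j ω, 0 ≤ σ j ω) (ht : ∀ j, 0 < t j) (hb : ∀ j, ∫ ω, σ j ω ∂P ≤ t j * b j)
    (hbs : Summable b) (hδ : ∑' j, b j ≤ δ) : 1 - δ ≤ P.real {ω | ∀ j, σ j ω ≤ t j} := by
  have hb0 : ∀ j, 0 ≤ b j := fun j =>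
    nonneg_of_mul_nonneg_right ((integral_nonneg (hσ j)).trans (hb j)) (ht j)
  have hcompl : {ω | ∀ j, σ j ω ≤ t j}ᶜ ⊆ ⋃ j, {ω | t j ≤ σ j ω} := fun ω hω => by
    simp only [Set.mem_compl_iff, Set.mem_ofPred_eq, not_forall, not_le] at hω
    obtain ⟨j, hj⟩ := hω
    exact Set.mem_iUnion.2 ⟨j, hj.le⟩
  have hP : P {ω | ∀ j, σ j ω ≤ t j}ᶜ ≤ ENNReal.ofReal δ := by
    refine (measure_mono hcompl).trans ((measure_iUnion_le _).trans ?_)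
    refine le_trans (ENNReal.tsum_le_tsum fun j => ?_)
      ((ENNReal.ofReal_tsum_of_nonneg hb0 hbs).symm.le.trans (ENNReal.ofReal_le_ofReal hδ))
    have hmk := mul_meas_ge_le_integral_of_nonneg (ae_of_all P (hσ j)) (hint j) (t j)
    rw [← ofReal_measureReal]
    exact ENNReal.ofReal_le_ofReal (le_of_mul_le_mul_left (hmk.trans (hb j)) (ht j))
  have hreal : P.real {ω | ∀ j, σ j ω ≤ t j}ᶜ ≤ δ :=
    ENNReal.toReal_le_of_le_ofReal ((tsum_nonneg hb0).trans hδ) hP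
  have hun := measureReal_union_le (μ := P) {ω | ∀ j, σ j ω ≤ t j} {ω | ∀ j, σ j ω ≤ t j}ᶜ
  rw [Set.union_compl_self, probReal_univ] at hun
  linarith

/-- The length `k₀ = ⌈8 a ln(a/δ)⌉` of the first phase, with `a = dκ`. -/
noncomputable def burnIn (d : ℕ) (κ δ : ℝ) : ℕ := ⌈8 * (d * κ * Real.log (d * κ / δ))⌉₊

lemma burnIn_le {d : ℕ} {κ δ : ℝ} (hd : 2 ≤ d) (hκ : 1 ≤ κ) (hδ0 : 0 < δ) (hδ1 : δ < 1) :
    (burnIn d κ δ : ℝ) ≤ 9 * (d * κ * Real.log (d * κ / δ)) := by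
  have hd' : (2 : ℝ) ≤ d := by exact_mod_cast hd
  have ha : 2 ≤ d * κ := by nlinarith
  have hlog : Real.log 2 ≤ Real.log (d * κ / δ) :=
    Real.log_le_log (by norm_num) (by rw [le_div_iff₀ hδ0]; nlinarith)
  have hlog2 := Real.log_two_gt_d9
  have h1 : 1 ≤ d * κ * Real.log (d * κ / δ) := by nlinarith
  have := Nat.ceil_lt_add_one (show 0 ≤ 8 * (d * κ * Real.log (d * κ / δ)) by linarith)
  rw [burnIn]
  linarith

/-- The union bound over the failure probabilities after the first phase; `9 a / (2/5) = 45 a / 2`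
comes from Markov's inequality and `a²` from the geometric series of ratio `1 - 1/a²`. -/
lemma mul_pow_burnIn_le {d : ℕ} {κ δ : ℝ} (hd : 2 ≤ d) (hκ : 1 ≤ κ) (hδ0 : 0 < δ) (hδ1 : δ < 1) :
    45 / 2 * (d * κ) ^ 3 * (1 - 1 / (d * κ)) ^ burnIn d κ δ ≤ δ := by
  have hd' : (2 : ℝ) ≤ d := by exact_mod_cast hd
  have ha : 2 ≤ d * κ := by nlinarith
  have hceil := Nat.le_ceil (8 * (d * κ * Real.log (d * κ / δ)))
  rw [← burnIn] at hceil
  generalize (d : ℝ) * κ = a at *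
  have hpow : (1 - 1 / a) ^ burnIn d κ δ ≤ (δ / a) ^ 8 := by
    have h1 : 1 - 1 / a ≤ Real.exp (-(1 / a)) := by linarith [Real.add_one_le_exp (-(1 / a))]
    have h2 : 0 ≤ 1 - 1 / a := by
      rw [sub_nonneg, div_le_one (by linarith)]; linarith
    refine (pow_le_pow_left₀ h2 h1 _).trans ?_
    rw [← Real.exp_nat_mul]
    have h3 : (δ / a) ^ 8 = Real.exp (-(8 * Real.log (a / δ))) := by
      have h := Real.exp_nat_mul (Real.log (δ / a)) 8
      rw [Real.exp_log (div_pos hδ0 (by linarith))] at h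
      rw [← h, ← mul_neg, ← Real.log_inv, inv_div, Nat.cast_ofNat]
    rw [h3]
    refine Real.exp_le_exp.2 ?_
    rw [mul_neg, neg_le_neg_iff, mul_one_div, le_div_iff₀ (by linarith)]
    linarith
  calc 45 / 2 * a ^ 3 * (1 - 1 / a) ^ burnIn d κ δ ≤ 45 / 2 * a ^ 3 * (δ / a) ^ 8 := by gcongr
    _ = 45 / 2 / a ^ 5 * δ ^ 7 * δ := by field_simp
    _ ≤ 1 * 1 * δ := by
      have h5 : (2 : ℝ) ^ 5 ≤ a ^ 5 := pow_le_pow_left₀ (by norm_num) ha 5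
      have h6 : 45 / 2 / a ^ 5 ≤ 1 := by
        rw [div_le_one (by positivity)]; linarith
      have h7 : δ ^ 7 ≤ 1 := pow_le_one₀ hδ0.le hδ1.le
      gcongr
    _ = δ := by ring

end HighProbability

end RandomBroyden

theorem mainTheorem2 :
    ∃ (C : ℝ) (k₀ : ℕ → ℝ → ℝ → ℕ),
      (∀ (d : ℕ) (κ δ : ℝ), 2 ≤ d → 1 ≤ κ → 0 < δ → δ < 1 →
        (k₀ d κ δ : ℝ) ≤ C * (d * κ * Real.log (d * κ / δ))) ∧
      ∀ (d : ℕ) (_ : 2 ≤ d) (f : EuclideanSpace ℝ (Fin d) → ℝ) (μ L M : ℝ)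
        (_ : RandomBroyden.StronglyConvexSmooth μ L f)
        (_ : RandomBroyden.StronglySelfConcordant M f)
        (κ : ℝ) (_ : κ = L / μ)
        (x₀ : EuclideanSpace ℝ (Fin d))
        (_ : M * RandomBroyden.lambda f x₀ ≤ Real.log (3 / 2) / (4 * κ))
        (D : Measure (EuclideanSpace ℝ (Fin d))) (_ : IsProbabilityMeasure D)
        (_ : RandomBroyden.IsotropicDirection D)
        (Ω : Type*) (mΩ : MeasurableSpace Ω) (P : Measure Ω) (_ : IsProbabilityMeasure P)
        (ℱ : Filtration ℕ mΩ)
        (u : ℕ → Ω → EuclideanSpace ℝ (Fin d)) (τ : ℕ → Ω → ℝ)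
        (_ : RandomBroyden.RandomChoices P ℱ D u τ)
        (δ : ℝ) (_ : 0 < δ) (_ : δ < 1),
        1 - δ ≤ P.real {ω | ∀ k : ℕ,
          RandomBroyden.lambda f
              (RandomBroyden.iterates f M L x₀ (fun j => u j ω) (fun j => τ j ω)
                (k₀ d κ δ + k)).1
            ≤ (1 - 1 / (d * κ + 1)) ^ (k * (k - 1) / 2) * (1 / 2) ^ k
              * (1 - 1 / (2 * κ)) ^ (k₀ d κ δ) * RandomBroyden.lambda f x₀} := by
  refine ⟨9, RandomBroyden.burnIn, fun d κ δ hd hκ hδ0 hδ1 =>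
    RandomBroyden.burnIn_le hd hκ hδ0 hδ1, ?_⟩
  intro d hd f μ L M hs hc κ hκ x₀ h0 D _ hD Ω mΩ P _ ℱ u τ hR δ hδ0 hδ1
  subst hκ
  have : NeZero d := ⟨by omega⟩
  have hκ := RandomBroyden.one_le_of_stronglyConvexSmooth hs
  have hd' : (2 : ℝ) ≤ d := by exact_mod_cast hd
  have hδ := RandomBroyden.mul_pow_burnIn_le hd hκ hδ0 hδ1
  have hE := fun k => hR.integral_potential_le hD hd hs hc h0 k
  set k₀ := RandomBroyden.burnIn d (L / μ) δ
  have ha : 2 ≤ d * (L / μ) := by nlinarith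
  -- Markov's inequality at the level `(2/5) (a/(a+1))ʲ`, `a = dκ`; the ratio of `1 - 1/a` and
  -- `a/(a+1)` is `1 - 1/a²`, so that the failure probabilities are summable
  have hprob := RandomBroyden.one_sub_le_measureReal_forall_le (P := P) (δ := δ)
    (σ := fun j ω => RandomBroyden.potential f
      (RandomBroyden.iterates f M L x₀ (fun j => u j ω) (fun j => τ j ω) (k₀ + j)))
    (t := fun j => 2 / 5 * (1 - 1 / (d * (L / μ) + 1)) ^ j)
    (b := fun j => 45 / 2 * (d * (L / μ)) * (1 - 1 / (d * (L / μ))) ^ k₀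
      * (1 - 1 / (d * (L / μ)) ^ 2) ^ j)
    (fun j => hR.integrable_potential hs hc h0 _)
    (fun j ω => RandomBroyden.potential_nonneg hs (RandomBroyden.iteratesBounds hs hc h0
      (fun j => u j ω) (fun k => hR.tau_mem k ω) _).hessian_le)
  have hsub : ∀ ω, (∀ j, RandomBroyden.potential f
      (RandomBroyden.iterates f M L x₀ (fun j => u j ω) (fun j => τ j ω) (k₀ + j))
        ≤ 2 / 5 * (1 - 1 / (d * (L / μ) + 1)) ^ j) → _ :=
    fun ω hω => RandomBroyden.lambda_iterates_le_of_potential_le hd hs hc h0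
      (fun k => hR.tau_mem k ω) k₀ hω
  refine (hprob ?_ ?_ ?_ ?_).trans (measureReal_mono hsub)
  all_goals
    clear hprob hsub
    generalize (d : ℝ) * (L / μ) = a at *
  · intro j
    have : 1 / (a + 1) < 1 := by rw [div_lt_one (by linarith)]; linarith
    have := pow_pos (sub_pos.2 this) j
    positivity
  · intro j
    refine (hE (k₀ + j)).trans_eq ?_
    have hratio : (1 - 1 / (a + 1)) * (1 - 1 / a ^ 2) = 1 - 1 / a := by
      have : a + 1 ≠ 0 := by linarith
      field_simp
      ring
    rw [pow_add, ← hratio, mul_pow _ _ j]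
    ring
  · refine (summable_geometric_of_lt_one ?_ ?_).mul_left _
    · rw [sub_nonneg, div_le_one (by positivity)]; nlinarith
    · have : 0 < 1 / a ^ 2 := by positivity
      linarith
  · rw [tsum_mul_left, tsum_geometric_of_lt_one, sub_sub_cancel, inv_div, div_one]
    · linarith
    · rw [sub_nonneg, div_le_one (by positivity)]; nlinarith
    · have : 0 < 1 / a ^ 2 := by positivity
      linarith
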